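/- Let $\bar M(c)$ be an $(n+1)$-dimensional smooth Riemannian manifold of constant curvature $c\in\mathbb R$, i.e. its curvature tensor $\bar R(X,Y)Z=\bar\nabla_X\bar\nabla_YZ-\bar\nabla_Y\bar\nabla_XZ-\bar\nabla_{[X,Y]}Z$ satisfies $\bar R(X,Y)Z=c\,(\langle Y,Z\rangle X-\langle X,Z\rangle Y)$. Let $M^n$ be a smooth (immersed) transversely orientable hypersurface in $\bar M(c)$ with the induced metric, Levi-Civita connection $\nabla$, a smooth unit normal vector field $N$, and the shape operator $A X=-(\bar\nabla_X N)^\top$. Suppose that, for some integer $k>2$, the operator $A$ has at each point of $M$ exactly $k$ distinct eigenvalues (principal curvatures) $\mu_1<\dots<\mu_k$, and let $\mathcal D_i=\ker(A-\mu_i\,\mathrm{id})$, $1\le i\le k$, be the corresponding eigen-distributions, with orthogonal complements $\mathcal D_i^\perp$ in $TM$. A distribution $\mathcal D\subset TM$ is called integrable if its integrability tensor $T(X,Y)=\frac12\,\widehat P\,[X,Y]$ vanishes for all smooth local sections $X,Y$ of $\mathcal D$, where $\widehat P:TM\to\mathcal D^\perp$ is the orthogonal projector. Put $\mathcal A(X,Y,Z)=\langle(\nabla_XA)Y,Z\rangle$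 for $X,Y,Z\in T_xM$, $x\in M$. Then all the distributions $\mathcal D_1^\perp,\dots,\mathcal D_k^\perp$ are integrable if and only if, for all $i<j<l$ and every $x\in M$, $$\mathcal A(X_i,X_j,X_l)=0\quad\text{for all } X_i\in\mathcal D_i(x),\ X_j\in\mathcal D_j(x),\ X_l\in\mathcal D_l(x).$$ -/

import Mathlib

open scoped Manifold ContDiff Bundle

noncomputable section Definitions

namespace RiemannianHypersurface

open Bundle

section General

variable
  {E : Type*} [NormedAddCommGroup E] [NormedSpace ℝ E] [FiniteDimensional ℝ E]
  {H : Type*} [TopologicalSpace H] {I : ModelWithCorners ℝ E H}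
  {M : Type*} [TopologicalSpace M] [ChartedSpace H M] [IsManifold I ∞ M]

instance tangentSpace_finiteDimensional (x : M) : FiniteDimensional ℝ (TangentSpace I x) :=
  inferInstanceAs (FiniteDimensional ℝ E)

/-- `X` is a smooth vector field on the set `U`. -/
def IsSmoothFieldOn (X : ∀ x : M, TangentSpace I x) (U : Set M) : Prop :=
  ContMDiffOn I I.tangent ∞ (fun x => (⟨x, X x⟩ : TangentBundle I M)) U

/-- The vector field `∇_X Y`. -/
def nabla (cov : CovariantDerivative I E (TangentSpace I : M → Type _))
    (X Y : ∀ x : M, TangentSpace I x) (x : M) : TangentSpace I x :=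
  cov Y x (X x)

/-- The curvature `R(X, Y) Z = ∇_X ∇_Y Z - ∇_Y ∇_X Z - ∇_[X, Y] Z` of a connection. -/
def curvature (cov : CovariantDerivative I E (TangentSpace I : M → Type _))
    (X Y Z : ∀ x : M, TangentSpace I x) (x : M) : TangentSpace I x :=
  nabla cov X (nabla cov Y Z) x - nabla cov Y (nabla cov X Z) x
    - nabla cov (VectorField.mlieBracket I X Y) Z x

/-- The covariant derivative `∇_v B` of a field `B` of endomorphisms of the tangent spaces,
`(∇_v B) w = ∇_v (B Y) - B (∇_v Y)`, where `Y` is a vector field with `Y x = w`, smooth near `x`.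
For a differentiable `B` the result does not depend on `Y`; we take the field that has constant
coordinates in the preferred trivialization of the tangent bundle at `x`. -/
def covDerivEnd (cov : CovariantDerivative I E (TangentSpace I : M → Type _))
    (B : ∀ x : M, TangentSpace I x →L[ℝ] TangentSpace I x)
    (x : M) (v w : TangentSpace I x) : TangentSpace I x :=
  cov (fun y => B y (FiberBundle.extend E w y)) x v - B x (cov (FiberBundle.extend E w) x v)

variable [RiemannianBundle (fun x : M => TangentSpace I x)]
  [IsContMDiffRiemannianBundle I ∞ E (fun x : M => TangentSpace I x)]

instance tangentSpace_completeSpace (x : M) : CompleteSpace (TangentSpace I x) :=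
  FiniteDimensional.complete ℝ _

/-- `cov` is the Levi-Civita connection of the Riemannian metric of `M`: it takes smooth fields
to smooth fields, it is torsion free, and it is compatible with the metric. -/
structure IsLeviCivita (cov : CovariantDerivative I E (TangentSpace I : M → Type _)) : Prop where
  smooth : ∀ U : Set M, IsOpen U → ContMDiffCovariantDerivativeOn E ∞ cov U
  torsion_eq_zero : cov.torsion = 0
  metric : ∀ (x : M) (Y Z : ∀ x : M, TangentSpace I x),
    MDifferentiableAt I I.tangent (fun y => (⟨y, Y y⟩ : TangentBundle I M)) x →
    MDifferentiableAt I I.tangent (fun y => (⟨y, Z y⟩ : TangentBundle I M)) x →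
    ∀ v : TangentSpace I x, mvfderiv I (fun y => inner ℝ (Y y) (Z y)) x v =
      inner ℝ (cov Y x v) (Z x) + inner ℝ (Y x) (cov Z x v)

/-- The metric of `M`, with Levi-Civita connection `cov`, has constant curvature `c`. -/
def HasConstantCurvature (cov : CovariantDerivative I E (TangentSpace I : M → Type _))
    (c : ℝ) : Prop :=
  ∀ (U : Set M), IsOpen U → ∀ X Y Z : ∀ x : M, TangentSpace I x,
    IsSmoothFieldOn X U → IsSmoothFieldOn Y U → IsSmoothFieldOn Z U → ∀ x ∈ U,
      curvature cov X Y Z x = c • (inner ℝ (Y x) (Z x) • X x - inner ℝ (X x) (Z x) • Y x)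

/-- The value at `x` of the integrability tensor `T(X, Y) = ½ P̂ [X, Y]` of a distribution `D`,
where `P̂` is the orthogonal projector onto the orthogonal complement of `D`. -/
def integrabilityTensor (D : ∀ x : M, Submodule ℝ (TangentSpace I x))
    (X Y : ∀ x : M, TangentSpace I x) (x : M) : TangentSpace I x :=
  (1 / 2 : ℝ) • ((D x)ᗮ.starProjection (VectorField.mlieBracket I X Y x))

/-- A distribution `D` is integrable if its integrability tensor vanishes on all smooth local
sections of `D`. -/
def IsIntegrable (D : ∀ x : M, Submodule ℝ (TangentSpace I x)) : Prop :=
  ∀ (U : Set M), IsOpen U → ∀ X Y : ∀ x : M, TangentSpace I x,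
    IsSmoothFieldOn X U → IsSmoothFieldOn Y U →
    (∀ x ∈ U, X x ∈ D x) → (∀ x ∈ U, Y x ∈ D x) →
    ∀ x ∈ U, integrabilityTensor D X Y x = 0

/-- The tensor `𝒜(u, v, w) = ⟨(∇_u A) v, w⟩` of a field `A` of endomorphisms. -/
def codazziTensor (cov : CovariantDerivative I E (TangentSpace I : M → Type _))
    (A : ∀ x : M, TangentSpace I x →L[ℝ] TangentSpace I x)
    (x : M) (u v w : TangentSpace I x) : ℝ :=
  inner ℝ (covDerivEnd cov A x u v) w

/-- `A` has exactly `k` distinct eigenvalues `μ 0 x < ⋯ < μ (k - 1) x` at each point `x`. -/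
structure HasDistinctEigenvalues {k : ℕ}
    (A : ∀ x : M, TangentSpace I x →L[ℝ] TangentSpace I x) (μ : Fin k → M → ℝ) : Prop where
  strictMono : ∀ x, StrictMono (fun i => μ i x)
  hasEigenvalue_iff : ∀ x r,
    Module.End.HasEigenvalue (A x : TangentSpace I x →ₗ[ℝ] TangentSpace I x) r ↔ ∃ i, μ i x = r

/-- The eigen-distribution `x ↦ ker (A x - μ x)`. -/
def eigenDistribution (A : ∀ x : M, TangentSpace I x →L[ℝ] TangentSpace I x) (μ : M → ℝ)
    (x : M) : Submodule ℝ (TangentSpace I x) :=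
  Module.End.eigenspace (A x : TangentSpace I x →ₗ[ℝ] TangentSpace I x) (μ x)

end General

section Hypersurface

variable
  {E : Type*} [NormedAddCommGroup E] [NormedSpace ℝ E] [FiniteDimensional ℝ E]
  {H : Type*} [TopologicalSpace H] {I : ModelWithCorners ℝ E H}
  {M : Type*} [TopologicalSpace M] [ChartedSpace H M] [IsManifold I ∞ M]
  {E' : Type*} [NormedAddCommGroup E'] [NormedSpace ℝ E'] [FiniteDimensional ℝ E']
  {H' : Type*} [TopologicalSpace H'] {J : ModelWithCorners ℝ E' H'}
  {M' : Type*} [TopologicalSpace M'] [ChartedSpace H' M'] [IsManifold J ∞ M']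

/-- The covariant derivative `v ↦ ∇_v σ` at `x` of a vector field `σ` along a map `f : M → M'`,
induced by a connection on `M'` (the pull-back connection). In the preferred trivialization of the
tangent bundle of `M'` at `f x`, with frame `(s_i)`, write `σ y = ∑ σ^i(y) s_i(f y)`; then
`∇_v σ = ∑ dσ^i(v) s_i + ∇_{df v} (∑ σ^i(x) s_i)`. The result does not depend on the frame. -/
def covAlong (cov : CovariantDerivative J E' (TangentSpace J : M' → Type _)) (f : M → M')
    (σ : ∀ x : M, TangentSpace J (f x)) (x : M) : TangentSpace I x →L[ℝ] TangentSpace J (f x) :=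
  ((trivializationAt E' (TangentSpace J : M' → Type _) (f x)).symmL ℝ (f x)) ∘L
      mvfderiv I (fun y =>
        (trivializationAt E' (TangentSpace J : M' → Type _) (f x) ⟨f y, σ y⟩).2) x
    + cov (FiberBundle.extend E' (σ x)) (f x) ∘L mfderiv I J f x

variable [RiemannianBundle (fun x : M => TangentSpace I x)]
  [RiemannianBundle (fun y : M' => TangentSpace J y)]

variable (I) in
/-- `f` is a smooth isometric immersion, and `ν` is a smooth unit normal field along `f`. -/
structure IsOrientedImmersion (f : M → M') (ν : ∀ x : M, TangentSpace J (f x)) : Prop where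
  smooth : ContMDiff I J ∞ f
  isometric : ∀ (x : M) (v w : TangentSpace I x),
    inner ℝ (mfderiv I J f x v) (mfderiv I J f x w) = inner ℝ v w
  smooth_normal : ContMDiff I J.tangent ∞ (fun x => (⟨f x, ν x⟩ : TangentBundle J M'))
  norm_normal : ∀ x, inner ℝ (ν x) (ν x) = (1 : ℝ)
  orthogonal : ∀ (x : M) (v : TangentSpace I x), inner ℝ (ν x) (mfderiv I J f x v) = (0 : ℝ)

/-- The shape operator `A v = -(∇̄_v ν)^⊤` of an isometric immersion `f` with respect to the
normal field `ν`. As `df` is isometric, its adjoint is the orthogonal projection onto the image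
of `df`, followed by the inverse of `df`. -/
def shapeOperator (cov : CovariantDerivative J E' (TangentSpace J : M' → Type _)) (f : M → M')
    (ν : ∀ x : M, TangentSpace J (f x)) (x : M) : TangentSpace I x →L[ℝ] TangentSpace I x :=
  -((ContinuousLinearMap.adjoint (mfderiv I J f x)) ∘L covAlong cov f ν x)

end Hypersurface

end RiemannianHypersurface

end Definitions

/-! Constant curvature makes the Codazzi equation read `(∇_u A) v = (∇_v A) u`, and `A` is
symmetric, so `𝒜` is totally symmetric. Let `X` be a section of `D_i`. For `w ∈ D_j` with `j ≠ i`,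
the product rule for `A X = μ_i X` gives `𝒜(v, X, w) = (μ_i - μ_j)⟨∇_v X, w⟩`. For sections `Y, Z`
of `D_iᗮ`, metric compatibility and vanishing torsion give `⟨[Y, Z], X⟩ = ⟨∇_Z X, Y⟩ - ⟨∇_Y X, Z⟩`.
So `D_iᗮ` is integrable exactly when the forms `(v, w) ↦ ⟨∇_v X, w⟩` are symmetric on `D_iᗮ`.

If they are symmetric, take `v ∈ D_j`, `w ∈ D_l` with `i, j, l` distinct and let `a` be the common
value. Then `𝒜(X, v, w)` equals both `(μ_i - μ_j) a` and `(μ_i - μ_l) a`, hence `a = 0` and `𝒜`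
vanishes. Conversely, split two vectors of `D_iᗮ` into eigenvectors: two components in the same
eigenspace are exchanged by the symmetry of `𝒜`, and for components in different ones both values of
the form are zero. These steps are `codazziTensor_eigenDistribution`,
`inner_mlieBracket_eigenDistribution`, `codazziTensor_eq_zero_of_isIntegrable` and
`isIntegrable_orthogonal_eigenDistribution`.

Two analytic inputs remain. `codazzi` rests on the calculus of fields along an immersion, where
everything is transferred to ambient fields by local extension. `contMDiff_eigenvalue` and
`exists_isSmoothFieldOn_eigenDistribution` show that the eigenvalues, given only as functions, are
smooth, and that eigenvectors extend to smooth sections. -/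

namespace RiemannianHypersurface

open Bundle Set Filter Topology VectorField

/-! ### Derivatives of functions along vector fields, and the Lie bracket as a commutator. -/

section Calculus

variable
  {E : Type*} [NormedAddCommGroup E] [NormedSpace ℝ E]
  {H : Type*} [TopologicalSpace H] {I : ModelWithCorners ℝ E H}
  {M : Type*} [TopologicalSpace M] [ChartedSpace H M]
  {E' : Type*} [NormedAddCommGroup E'] [NormedSpace ℝ E']
  {H' : Type*} [TopologicalSpace H'] {J : ModelWithCorners ℝ E' H'}
  {M' : Type*} [TopologicalSpace M'] [ChartedSpace H' M']
  {F : Type*} [NormedAddCommGroup F] [NormedSpace ℝ F]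

theorem mvfderiv_comp_eq {g : M' → F} {f : M → M'} {x : M}
    (hg : MDifferentiableAt J 𝓘(ℝ, F) g (f x)) (hf : MDifferentiableAt I J f x)
    (v : TangentSpace I x) :
    mvfderiv I (fun y => g (f y)) x v = mvfderiv J g (f x) (mfderiv I J f x v) :=
  mfderiv_comp_apply x hg hf v

theorem mvfderiv_congr {g h : M → F} {x : M} (hgh : g =ᶠ[𝓝 x] h) (v : TangentSpace I x) :
    mvfderiv I g x v = mvfderiv I h x v := by
  have h1 : mfderiv I 𝓘(ℝ, F) g x = mfderiv I 𝓘(ℝ, F) h x := hgh.mfderiv_eq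
  exact congrArg (fun T : E →L[ℝ] F => T v) h1

/-- The derivative of a function along a vector field, read in the chart at `x`. -/
theorem fderiv_comp_extChartAt_symm [IsManifold I 1 M] [I.Boundaryless] {x : M} {g : M → F}
    (X : ∀ y : M, TangentSpace I y)
    {z : E} (hz : z ∈ (extChartAt I x).target)
    (hg : MDifferentiableAt I 𝓘(ℝ, F) g ((extChartAt I x).symm z)) :
    fderiv ℝ (fun z => g ((extChartAt I x).symm z)) z
        (mpullbackWithin 𝓘(ℝ, E) I (extChartAt I x).symm X (range I) z) =
      mvfderiv I g ((extChartAt I x).symm z) (X ((extChartAt I x).symm z)) := by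
  have hinv := isInvertible_mfderivWithin_extChartAt_symm (I := I) hz
  have hr : range I = univ := I.range_eq_univ
  have hd := mdifferentiableWithinAt_extChartAt_symm (I := I) hz
  simp only [mpullbackWithin_apply]
  rw [hr] at hinv hd ⊢
  rw [mdifferentiableWithinAt_univ] at hd
  rw [mfderivWithin_univ] at hinv ⊢
  have h1 : fderiv ℝ (fun z => g ((extChartAt I x).symm z)) z =
      (mvfderiv I g ((extChartAt I x).symm z)).comp
        (mfderiv 𝓘(ℝ, E) I (extChartAt I x).symm z) := by
    ext v
    refine Eq.trans ?_ (mvfderiv_comp_eq (I := 𝓘(ℝ, E)) hg hd v)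
    simp only [mvfderiv, mfderiv_eq_fderiv]
    rfl
  rw [h1]
  have h2 := hinv.self_comp_inverse
  exact congrArg (mvfderiv I g ((extChartAt I x).symm z))
    (congrArg (fun T : E →L[ℝ] E => T (X ((extChartAt I x).symm z))) h2)

theorem inverse_apply_inverse_apply {V : Type*} [NormedAddCommGroup V] [NormedSpace ℝ V]
    {S : V →L[ℝ] E} {T : E →L[ℝ] V} (h₁ : S ∘L T = ContinuousLinearMap.id ℝ E)
    (h₂ : T ∘L S = ContinuousLinearMap.id ℝ V) (b : V) : S.inverse (T.inverse b) = b := by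
  rw [ContinuousLinearMap.inverse_eq h₂ h₁, ContinuousLinearMap.inverse_eq h₁ h₂]
  exact congrArg (fun U : V →L[ℝ] V => U b) h₂

variable [I.Boundaryless]

theorem contDiffAt_comp_extChartAt_symm {x : M} {h : M → F} {n : ℕ∞ω} [IsManifold I n M]
    (hh : ContMDiffAt I 𝓘(ℝ, F) n h x) :
    ContDiffAt ℝ n (fun z => h ((extChartAt I x).symm z)) (extChartAt I x x) := by
  have h1 : ContMDiffAt 𝓘(ℝ, E) I n (extChartAt I x).symm (extChartAt I x x) :=
    (contMDiffOn_extChartAt_symm x).contMDiffAt (extChartAt_target_mem_nhds x)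
  have h2 : ContMDiffAt I 𝓘(ℝ, F) n h ((extChartAt I x).symm (extChartAt I x x)) := by
    rwa [extChartAt_to_inv]
  exact (h2.comp _ h1).contDiffAt

variable [IsManifold I 2 M]

theorem eventually_fderiv_comp_extChartAt_symm {x : M} {h : M → F}
    (hh : ContMDiffAt I 𝓘(ℝ, F) 1 h x) (X : ∀ y : M, TangentSpace I y) :
    (fun z => mvfderiv I h ((extChartAt I x).symm z) (X ((extChartAt I x).symm z)))
      =ᶠ[𝓝 (extChartAt I x x)]
      fun z => fderiv ℝ (fun z => h ((extChartAt I x).symm z)) z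
        (mpullbackWithin 𝓘(ℝ, E) I (extChartAt I x).symm X (range I) z) := by
  have : IsManifold I 1 M := IsManifold.of_le (n := 2) (by norm_num)
  have h1 : ∀ᶠ y in 𝓝 x, MDifferentiableAt I 𝓘(ℝ, F) h y :=
    ((contMDiffAt_iff_contMDiffAt_nhds (by simp)).1 hh).mono fun y hy =>
      hy.mdifferentiableAt one_ne_zero
  have h2 := (continuousAt_extChartAt_symm (I := I) x).eventually
    (by rwa [extChartAt_to_inv] : ∀ᶠ y in 𝓝 ((extChartAt I x).symm (extChartAt I x x)), _)
  filter_upwards [h2, extChartAt_target_mem_nhds (I := I) x] with z hz hzt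
  exact (fderiv_comp_extChartAt_symm X hzt hz).symm

variable [CompleteSpace E]

theorem mpullbackWithin_extChartAt_symm_differentiableAt {x : M} {X : ∀ y : M, TangentSpace I y}
    (hX : MDifferentiableAt I I.tangent (fun y => (⟨y, X y⟩ : TangentBundle I M)) x) :
    DifferentiableAt ℝ (mpullbackWithin 𝓘(ℝ, E) I (extChartAt I x).symm X (range I))
      (extChartAt I x x) := by
  refine (MDifferentiableWithinAt.differentiableWithinAt_mpullbackWithin_vectorField
    (mdifferentiableWithinAt_univ.2 hX)).differentiableAt ?_
  simp [I.range_eq_univ]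

theorem mdifferentiableAt_mvfderiv_apply {x : M} {h : M → F}
    (hh : ContMDiffAt I 𝓘(ℝ, F) 2 h x) {X : ∀ y : M, TangentSpace I y}
    (hX : MDifferentiableAt I I.tangent (fun y => (⟨y, X y⟩ : TangentBundle I M)) x) :
    MDifferentiableAt I 𝓘(ℝ, F) (fun y => mvfderiv I h y (X y)) x := by
  have h1 := eventually_fderiv_comp_extChartAt_symm (hh.of_le (by norm_num)) X
  have h2 : DifferentiableAt ℝ
      (fun z => mvfderiv I h ((extChartAt I x).symm z) (X ((extChartAt I x).symm z)))
      (extChartAt I x x) := by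
    refine DifferentiableAt.congr_of_eventuallyEq ?_ h1
    refine DifferentiableAt.clm_apply ?_ (mpullbackWithin_extChartAt_symm_differentiableAt hX)
    exact ((contDiffAt_comp_extChartAt_symm hh).fderiv_right (m := 1)
      (by norm_num)).differentiableAt one_ne_zero
  have h3 : MDifferentiableAt I 𝓘(ℝ, F) (fun y => (fun z => mvfderiv I h ((extChartAt I x).symm z)
      (X ((extChartAt I x).symm z))) (extChartAt I x y)) x :=
    MDifferentiableAt.comp (I' := 𝓘(ℝ, E)) x h2.mdifferentiableAt
      (mdifferentiableAt_extChartAt (mem_chart_source H x))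
  refine h3.congr_of_eventuallyEq ?_
  filter_upwards [extChartAt_source_mem_nhds (I := I) x] with y hy
  rw [(extChartAt I x).left_inv hy]

/-- The Lie bracket acts on functions as the commutator of derivations. -/
theorem mvfderiv_mlieBracket {x : M} {h : M → F}
    (hh : ContMDiffAt I 𝓘(ℝ, F) 2 h x) {X Y : ∀ y : M, TangentSpace I y}
    (hX : MDifferentiableAt I I.tangent (fun y => (⟨y, X y⟩ : TangentBundle I M)) x)
    (hY : MDifferentiableAt I I.tangent (fun y => (⟨y, Y y⟩ : TangentBundle I M)) x) :
    mvfderiv I h x (mlieBracket I X Y x) =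
      mvfderiv I (fun y => mvfderiv I h y (Y y)) x (X x) -
        mvfderiv I (fun y => mvfderiv I h y (X y)) x (Y x) := by
  have : IsManifold I 1 M := IsManifold.of_le (n := 2) (by norm_num)
  have hz := mem_extChartAt_target (I := I) x
  have key : ∀ (g : M → F) (Z : ∀ y : M, TangentSpace I y), MDifferentiableAt I 𝓘(ℝ, F) g x →
      fderiv ℝ (fun z => g ((extChartAt I x).symm z)) (extChartAt I x x)
        (mpullbackWithin 𝓘(ℝ, E) I (extChartAt I x).symm Z (range I) (extChartAt I x x)) =
      mvfderiv I g x (Z x) := by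
    intro g Z hg
    have := fderiv_comp_extChartAt_symm (g := g) Z hz (by rwa [extChartAt_to_inv])
    rw [this, extChartAt_to_inv]
  have hV := mpullbackWithin_extChartAt_symm_differentiableAt hX
  have hW := mpullbackWithin_extChartAt_symm_differentiableAt hY
  have hb := fderiv_apply_lieBracket (contDiffAt_comp_extChartAt_symm hh)
    (minSmoothness_of_isRCLikeNormedField.le) hW hV
  rw [← key _ X (mdifferentiableAt_mvfderiv_apply hh hY),
    ← key _ Y (mdifferentiableAt_mvfderiv_apply hh hX),
    (eventually_fderiv_comp_extChartAt_symm (hh.of_le (by norm_num)) X).fderiv_eq,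
    (eventually_fderiv_comp_extChartAt_symm (hh.of_le (by norm_num)) Y).fderiv_eq, ← hb]
  rw [← key h _ (hh.mdifferentiableAt two_ne_zero)]
  -- The manifold bracket is the chart bracket transported by the inverse of the differential of the
  -- chart. Pulling it back along the inverse chart undoes this, since the two differentials are
  -- mutually inverse.
  congr 1
  rw [mpullbackWithin_apply, extChartAt_to_inv, ← mlieBracketWithin_univ, mlieBracketWithin_apply]
  have h1 := mfderivWithin_extChartAt_symm_comp_mfderiv_extChartAt (I := I) hz
  have h2 := mfderiv_extChartAt_comp_mfderivWithin_extChartAt_symm (I := I) hz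
  rw [extChartAt_to_inv] at h1 h2
  have h3 : ∀ V W : E → E, lieBracketWithin ℝ V W
      ((extChartAt I x).symm ⁻¹' univ ∩ range I) (extChartAt I x x) =
      lieBracket ℝ V W (extChartAt I x x) := fun V W => by
    rw [preimage_univ, univ_inter, I.range_eq_univ, lieBracketWithin_univ]
  refine (inverse_apply_inverse_apply (E := E) (V := E) h1 h2 _).trans (h3 _ _)

end Calculus

/-! ### Local left inverses of immersions. -/

section LeftInverse

theorem exists_contDiffOn_local_inverse {E : Type*} [NormedAddCommGroup E] [NormedSpace ℝ E]
    [CompleteSpace E] {G : E → E} {O : Set E} (hO : IsOpen O) (hG : ContDiffOn ℝ ∞ G O) {p : E}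
    (hp : p ∈ O) (hid : HasFDerivAt G (ContinuousLinearMap.id ℝ E) p) :
    ∃ (g : E → E) (V : Set E), IsOpen V ∧ G p ∈ V ∧ ContDiffOn ℝ ∞ g V ∧ MapsTo g V O ∧
      ∀ᶠ z in 𝓝 p, g (G z) = z := by
  have hGp : ContDiffAt ℝ ∞ G p := hG.contDiffAt (hO.mem_nhds hp)
  have hid' : HasFDerivAt G ((ContinuousLinearEquiv.refl ℝ E : E ≃L[ℝ] E) : E →L[ℝ] E) p := hid
  set e := hGp.toOpenPartialHomeomorph G hid' (by simp) with he
  have hep : p ∈ e.source := hGp.mem_toOpenPartialHomeomorph_source hid' (by simp)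
  have hecoe : ∀ z, e z = G z := fun z => rfl
  have hcont : ContinuousOn (fderiv ℝ G) O := hG.continuousOn_fderiv_of_isOpen hO (by simp)
  -- The local inverse is smooth at each point over which the derivative of `G` is invertible. Units
  -- form an open set, so restricting to such points gives smoothness on an open neighbourhood and
  -- not only at `G p`.
  let O' : Set E := O ∩ fderiv ℝ G ⁻¹' {T | IsUnit T}
  have hO' : IsOpen O' := hcont.isOpen_inter_preimage hO Units.isOpen
  have hpO' : p ∈ O' := ⟨hp, by
    change IsUnit (fderiv ℝ G p)
    rw [hid.fderiv]
    exact isUnit_one⟩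
  refine ⟨e.symm, e.target ∩ e.symm ⁻¹' O', e.isOpen_inter_preimage_symm hO', ⟨?_, ?_⟩, ?_, ?_, ?_⟩
  · exact e.map_source hep
  · change e.symm (e p) ∈ O'
    rwa [e.left_inv hep]
  · rintro q ⟨hq, hqO, u, hu⟩
    refine (e.contDiffAt_symm (f₀' := ContinuousLinearEquiv.ofUnit u) hq ?_ ?_).contDiffWithinAt
    · have hd : DifferentiableAt ℝ G (e.symm q) :=
        ((hG _ hqO).contDiffAt (hO.mem_nhds hqO)).differentiableAt (by simp)
      have := hd.hasFDerivAt
      rw [← hu] at this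
      exact this
    · exact (hG _ hqO).contDiffAt (hO.mem_nhds hqO)
  · exact fun q hq => hq.2.1
  · filter_upwards [e.open_source.mem_nhds hep] with z hz
    exact e.left_inv hz

variable
  {E : Type*} [NormedAddCommGroup E] [NormedSpace ℝ E] [CompleteSpace E]
  {H : Type*} [TopologicalSpace H] {I : ModelWithCorners ℝ E H} [I.Boundaryless]
  {M : Type*} [TopologicalSpace M] [ChartedSpace H M] [IsManifold I ∞ M]
  {E' : Type*} [NormedAddCommGroup E'] [NormedSpace ℝ E'] [FiniteDimensional ℝ E']
  {H' : Type*} [TopologicalSpace H'] {J : ModelWithCorners ℝ E' H'}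
  {M' : Type*} [TopologicalSpace M'] [ChartedSpace H' M'] [IsManifold J ∞ M']

/-- A smooth map with injective differential at `x` has a smooth left inverse near `x`. -/
theorem exists_contMDiffOn_local_leftInverse {f : M → M'} (hf : ContMDiff I J ∞ f) {x : M}
    (hinj : Function.Injective (mfderiv I J f x)) :
    ∃ (r : M' → M) (V : Set M'), IsOpen V ∧ f x ∈ V ∧ ContMDiffOn J I ∞ r V ∧
      ∀ᶠ y in 𝓝 x, r (f y) = y := by
  set φ := extChartAt I x with hφ
  set ψ := extChartAt J (f x) with hψ
  have hφp : φ.symm (φ x) = x := extChartAt_to_inv x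
  let Φ : E → E' := fun z => ψ (f (φ.symm z))
  -- With `L` a linear left inverse of the differential in charts, `L ∘ Φ` has derivative the
  -- identity at `φ x`. A local inverse `g` of it yields the left inverse `φ.symm ∘ g ∘ L ∘ ψ` of
  -- `f`.
  obtain ⟨L, hL⟩ : ∃ L : E' →L[ℝ] E, L ∘L fderiv ℝ Φ (φ x) = ContinuousLinearMap.id ℝ E := by
    have h1 : mfderiv I J f x = fderiv ℝ Φ (φ x) := by
      have hd : MDifferentiableAt I J f x := hf.mdifferentiable (by simp) x
      have h3 := hd.mfderiv
      rw [I.range_eq_univ] at h3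
      exact h3.trans (congrFun (fderivWithin_univ (𝕜 := ℝ) (f := Φ)) _)
    have h2 : Function.Injective (fderiv ℝ Φ (φ x) : E →ₗ[ℝ] E') := by
      have := hinj
      rw [h1] at this
      exact this
    have : FiniteDimensional ℝ E := FiniteDimensional.of_injective (fderiv ℝ Φ (φ x) : E →ₗ[ℝ] E') h2
    obtain ⟨L, hL⟩ := LinearMap.exists_leftInverse_of_injective _ (LinearMap.ker_eq_bot.2 h2)
    exact ⟨L.toContinuousLinearMap, ContinuousLinearMap.ext fun v =>
      congrArg (fun T : E →ₗ[ℝ] E => T v) hL⟩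
  let O : Set E := φ.target ∩ (fun z => f (φ.symm z)) ⁻¹' ψ.source
  have hcs : ContinuousOn φ.symm φ.target := continuousOn_extChartAt_symm x
  have hO : IsOpen O := (hf.continuous.comp_continuousOn hcs).isOpen_inter_preimage
    (isOpen_extChartAt_target x) (isOpen_extChartAt_source _)
  have hp : φ x ∈ O := ⟨mem_extChartAt_target x, by
    change f (φ.symm (φ x)) ∈ ψ.source
    rw [hφp]; exact mem_extChartAt_source _⟩
  have hΦ : ContDiffOn ℝ ∞ Φ O := by
    rw [← contMDiffOn_iff_contDiffOn]
    refine (contMDiffOn_extChartAt (I := J) (x := f x)).comp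
      ((hf.contMDiffOn (s := univ)).comp
        ((contMDiffOn_extChartAt_symm x).mono inter_subset_left) (fun _ _ => mem_univ _)) ?_
    intro z hz
    have := hz.2
    rwa [mem_preimage, hψ, extChartAt_source] at this
  have hLΦ : ContDiffOn ℝ ∞ (fun z => L (Φ z)) O := L.contDiff.comp_contDiffOn hΦ
  have hid : HasFDerivAt (fun z => L (Φ z)) (ContinuousLinearMap.id ℝ E) (φ x) := by
    rw [← hL]
    exact L.hasFDerivAt.comp _
      ((hΦ.contDiffAt (hO.mem_nhds hp)).differentiableAt (by simp)).hasFDerivAt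
  obtain ⟨g, V, hV, hpV, hgV, hgO, hleft⟩ := exists_contDiffOn_local_inverse hO hLΦ hp hid
  have hψc : ContinuousOn (fun q => L (ψ q)) ψ.source :=
    L.continuous.comp_continuousOn (continuousOn_extChartAt _)
  refine ⟨fun q => φ.symm (g (L (ψ q))), ψ.source ∩ (fun q => L (ψ q)) ⁻¹' V,
    hψc.isOpen_inter_preimage (isOpen_extChartAt_source _) hV, ⟨mem_extChartAt_source _, ?_⟩, ?_, ?_⟩
  · have : L (Φ (φ x)) ∈ V := hpV
    change L (ψ (f x)) ∈ V
    simpa only [Φ, hφp] using this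
  · refine (contMDiffOn_extChartAt_symm x).comp (t := φ.target) (hgV.contMDiffOn.comp (t := V)
      (L.contDiff.contMDiff.comp_contMDiffOn ((contMDiffOn_extChartAt (I := J) (x := f x)).mono ?_))
      ?_) ?_
    · rw [hψ, extChartAt_source]; exact inter_subset_left
    · exact fun q hq => hq.2
    · exact fun q hq => (hgO hq.2).1
  · have h1 := (continuousAt_extChartAt (I := I) x).eventually hleft
    filter_upwards [h1, extChartAt_source_mem_nhds (I := I) x] with y hy hys
    have hy' : g (L (ψ (f (φ.symm (φ y))))) = φ y := hy
    rw [φ.left_inv hys] at hy'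
    change φ.symm (g (L (ψ (f y)))) = y
    rw [hy', φ.left_inv hys]

end LeftInverse

/-! ### Vector fields along a map and the pull-back connection. -/

section Along

set_option linter.unusedSectionVars false

variable
  {E : Type*} [NormedAddCommGroup E] [NormedSpace ℝ E] [FiniteDimensional ℝ E]
  {H : Type*} [TopologicalSpace H] {I : ModelWithCorners ℝ E H}
  {M : Type*} [TopologicalSpace M] [ChartedSpace H M] [IsManifold I ∞ M]
  {E' : Type*} [NormedAddCommGroup E'] [NormedSpace ℝ E'] [FiniteDimensional ℝ E']
  {H' : Type*} [TopologicalSpace H'] {J : ModelWithCorners ℝ E' H'}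
  {M' : Type*} [TopologicalSpace M'] [ChartedSpace H' M'] [IsManifold J ∞ M']

variable (I J) in
/-- `σ` is a smooth vector field along the map `f`, on the set `U`. -/
def IsSmoothAlongOn (f : M → M') (σ : ∀ x : M, TangentSpace J (f x)) (U : Set M) : Prop :=
  ContMDiffOn I J.tangent ∞ (fun x => (⟨f x, σ x⟩ : TangentBundle J M')) U

theorem IsSmoothFieldOn.mdifferentiableAt {X : ∀ x : M, TangentSpace I x} {U : Set M}
    (hX : IsSmoothFieldOn X U) (hU : IsOpen U) {x : M} (hx : x ∈ U) :
    MDifferentiableAt I I.tangent (fun y => (⟨y, X y⟩ : TangentBundle I M)) x :=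
  (hX.contMDiffAt (hU.mem_nhds hx)).mdifferentiableAt (by simp)

theorem IsSmoothFieldOn.mono {X : ∀ x : M, TangentSpace I x} {U V : Set M}
    (hX : IsSmoothFieldOn X U) (hVU : V ⊆ U) : IsSmoothFieldOn X V :=
  ContMDiffOn.mono hX hVU

theorem isSmoothFieldOn_extend (x : M) (v : TangentSpace I x) :
    ∃ U : Set M, IsOpen U ∧ x ∈ U ∧
      IsSmoothFieldOn (FiberBundle.extend E v : ∀ y : M, TangentSpace I y) U := by
  obtain ⟨s, hs, h⟩ := FiberBundle.exists_contMDiffOn_extend (k := ∞) I E v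
  obtain ⟨U, hUs, hU, hxU⟩ := mem_nhds_iff.1 hs
  exact ⟨U, hU, hxU, ContMDiffOn.mono h hUs⟩

theorem mdifferentiableAt_trivialization_snd {t : ∀ q : M', TangentSpace J q} {p : M'}
    (ht : MDifferentiableAt J J.tangent (fun q => (⟨q, t q⟩ : TangentBundle J M')) p) :
    MDifferentiableAt J 𝓘(ℝ, E')
      (fun q => (trivializationAt E' (TangentSpace J : M' → Type _) p ⟨q, t q⟩).2) p :=
  ((trivializationAt E' (TangentSpace J : M' → Type _) p).mdifferentiableAt_section_iff J t
    (FiberBundle.mem_baseSet_trivializationAt' p)).1 ht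

/-- A connection in a local trivialization: the derivative of the components plus the derivative
of the field with constant components. -/
theorem cov_eq_trivialization (cov : CovariantDerivative J E' (TangentSpace J : M' → Type _))
    {t : ∀ q : M', TangentSpace J q} {p : M'}
    (ht : MDifferentiableAt J J.tangent (fun q => (⟨q, t q⟩ : TangentBundle J M')) p)
    (w : TangentSpace J p) :
    cov t p w = (trivializationAt E' (TangentSpace J : M' → Type _) p).symmL ℝ p
        (mvfderiv J (fun q => (trivializationAt E' (TangentSpace J : M' → Type _) p ⟨q, t q⟩).2)
          p w) + cov (FiberBundle.extend E' (t p)) p w := by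
  set e := trivializationAt E' (TangentSpace J : M' → Type _) p with he
  have hpe : p ∈ e.baseSet := FiberBundle.mem_baseSet_trivializationAt' p
  have hbs : ∀ᶠ q in 𝓝 p, q ∈ e.baseSet := e.open_baseSet.mem_nhds hpe
  -- Both terms obey the same Leibniz rule, so their difference is tensorial and depends only on `t
  -- p`. It can therefore be evaluated on the field with constant components, for which the second
  -- term vanishes.
  let Ψ : (∀ q : M', TangentSpace J q) → TangentSpace J p := fun t =>
    cov t p w - e.symmL ℝ p (mvfderiv J (fun q => (e ⟨q, t q⟩).2) p w)
  have hΨ : TensorialAt J E' Ψ p := by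
    refine ⟨fun {g σ} hg hσ => ?_, fun {σ σ'} hσ hσ' => ?_⟩
    · have h1 : (fun q => (e ⟨q, (g • σ) q⟩).2) =ᶠ[𝓝 p] g • fun q => (e ⟨q, σ q⟩).2 := by
        filter_upwards [hbs] with q hq
        exact (e.linear ℝ hq).map_smul (g q) (σ q)
      have h2 := mvfderiv_smul hg (mdifferentiableAt_trivialization_snd hσ)
      have h3 := cov.isCovariantDerivativeOnUniv.leibniz hσ hg
      simp only [Ψ]
      rw [mvfderiv_congr h1 w, h2, h3]
      simp only [add_apply, smul_apply, ContinuousLinearMap.smulRight_apply,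
        map_add, map_smul, smul_sub]
      have h4 : e.symmL ℝ p (e ⟨p, σ p⟩).2 = σ p := by
        rw [e.symmL_apply hpe]
        exact e.symm_apply_apply_mk hpe (σ p)
      rw [← he, h4]
      abel
    · have h1 : (fun q => (e ⟨q, (σ + σ') q⟩).2) =ᶠ[𝓝 p]
          (fun q => (e ⟨q, σ q⟩).2) + fun q => (e ⟨q, σ' q⟩).2 := by
        filter_upwards [hbs] with q hq
        exact (e.linear ℝ hq).map_add (σ q) (σ' q)
      have h2 := mvfderiv_add (mdifferentiableAt_trivialization_snd hσ)
        (mdifferentiableAt_trivialization_snd hσ')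
      have h3 := cov.isCovariantDerivativeOnUniv.add hσ hσ'
      simp only [Ψ]
      rw [mvfderiv_congr h1 w, h2, h3]
      simp only [add_apply, map_add]
      abel
  have hext := FiberBundle.mdifferentiableAt_extend J E' (t p)
  have key : Ψ t = Ψ (FiberBundle.extend E' (t p)) :=
    hΨ.pointwise ht hext (FiberBundle.extend_apply_self E' (t p)).symm
  have hconst : (fun q => (e ⟨q, FiberBundle.extend E' (t p) q⟩).2) =ᶠ[𝓝 p]
      fun _ => (e ⟨p, t p⟩).2 := by
    filter_upwards [hbs] with q hq
    simp [FiberBundle.extend, ← he, hq]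
  simp only [Ψ] at key
  rw [mvfderiv_congr hconst w, mvfderiv_const] at key
  simp only [zero_apply, map_zero, sub_zero] at key
  rw [← key]
  abel

/-- The chain rule for the components in the trivialization. Through this lemma the metric, torsion
and curvature identities pass from the ambient connection to fields along `f`. -/
theorem covAlong_eq_of_eventuallyEq
    (cov : CovariantDerivative J E' (TangentSpace J : M' → Type _)) {f : M → M'} {x : M}
    (hf : MDifferentiableAt I J f x) {σ : ∀ y : M, TangentSpace J (f y)}
    {t : ∀ q : M', TangentSpace J q}
    (ht : MDifferentiableAt J J.tangent (fun q => (⟨q, t q⟩ : TangentBundle J M')) (f x))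
    (hσ : ∀ᶠ y in 𝓝 x, σ y = t (f y)) (v : TangentSpace I x) :
    covAlong cov f σ x v = cov t (f x) (mfderiv I J f x v) := by
  have hσx : σ x = t (f x) := hσ.self_of_nhds
  rw [cov_eq_trivialization cov ht, ← mvfderiv_comp_eq (mdifferentiableAt_trivialization_snd ht) hf]
  simp only [covAlong, add_apply, ContinuousLinearMap.comp_apply, hσx]
  congr 2
  refine mvfderiv_congr ?_ v
  filter_upwards [hσ] with y hy
  rw [hy]

/-- A smooth field along an immersion is locally the restriction of a smooth field. -/
theorem IsSmoothAlongOn.exists_extension [I.Boundaryless] {f : M → M'} (hf : ContMDiff I J ∞ f)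
    {x : M} (hinj : Function.Injective (mfderiv I J f x))
    {σ : ∀ y : M, TangentSpace J (f y)} {U : Set M} (hU : IsOpen U) (hx : x ∈ U)
    (hσ : IsSmoothAlongOn I J f σ U) :
    ∃ (t : ∀ q : M', TangentSpace J q) (V : Set M'), IsOpen V ∧ f x ∈ V ∧ IsSmoothFieldOn t V ∧
      ∀ᶠ y in 𝓝 x, σ y = t (f y) := by
  obtain ⟨r, V, hV, hxV, hr, hleft⟩ := exists_contMDiffOn_local_leftInverse hf hinj
  set e := trivializationAt E' (TangentSpace J : M' → Type _) (f x) with he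
  have hpe : f x ∈ e.baseSet := FiberBundle.mem_baseSet_trivializationAt' _
  have hrx : r (f x) = x := hleft.self_of_nhds
  let W : Set M := U ∩ f ⁻¹' e.baseSet
  have hW : IsOpen W := hU.inter (e.open_baseSet.preimage hf.continuous)
  let V' : Set M' := e.baseSet ∩ (V ∩ r ⁻¹' W)
  have hV' : IsOpen V' := e.open_baseSet.inter (hr.continuousOn.isOpen_inter_preimage hV hW)
  have hτ : ContMDiffOn I 𝓘(ℝ, E') ∞ (fun y => (e ⟨f y, σ y⟩).2) W :=
    ((e.contMDiffOn_iff (IB := J) (fun y hy => (e.mem_source).2 hy.2)).1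
      (hσ.mono inter_subset_left)).2
  -- Off the image of `f` the vector `σ (r q)` lies over `f (r q)`, not over `q`. The trivialization
  -- carries its components to the fibre over `q`.
  refine ⟨fun q => e.symm q (e ⟨f (r q), σ (r q)⟩).2, V', hV', ⟨hpe, hxV, ?_⟩, ?_, ?_⟩
  · change r (f x) ∈ W
    rw [hrx]; exact ⟨hx, hpe⟩
  · refine (e.contMDiffOn_section_iff hV' inter_subset_left).2 ?_
    refine (hτ.comp (hr.mono fun q hq => hq.2.1) fun q hq => hq.2.2).congr fun q hq => ?_
    simp [hq.1]
  · filter_upwards [hleft, hW.mem_nhds ⟨hx, hpe⟩] with y hy hyW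
    have := congrArg (fun z => e.symm (f y) (e ⟨f z, σ z⟩).2) hy
    refine Eq.trans ?_ this.symm
    exact (e.symm_apply_apply_mk hyW.2 (σ y)).symm

end Along

/-! ### Related vector fields, and the structure equations along an immersion. -/

section Immersion

set_option linter.unusedSectionVars false

variable
  {E : Type*} [NormedAddCommGroup E] [NormedSpace ℝ E] [FiniteDimensional ℝ E]
  {H : Type*} [TopologicalSpace H] {I : ModelWithCorners ℝ E H}
  {M : Type*} [TopologicalSpace M] [ChartedSpace H M] [IsManifold I ∞ M]
  {E' : Type*} [NormedAddCommGroup E'] [NormedSpace ℝ E'] [FiniteDimensional ℝ E']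
  {H' : Type*} [TopologicalSpace H'] {J : ModelWithCorners ℝ E' H'}
  {M' : Type*} [TopologicalSpace M'] [ChartedSpace H' M'] [IsManifold J ∞ M']

theorem isSmoothAlongOn_mfderiv {f : M → M'} (hf : ContMDiff I J ∞ f)
    {X : ∀ x : M, TangentSpace I x} {U : Set M} (hX : IsSmoothFieldOn X U) :
    IsSmoothAlongOn I J f (fun y => mfderiv I J f y (X y)) U :=
  (hf.contMDiff_tangentMap (m := ∞) (by simp)).comp_contMDiffOn hX

theorem IsSmoothFieldOn.comp_isSmoothAlongOn {f : M → M'} (hf : ContMDiff I J ∞ f)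
    {t : ∀ q : M', TangentSpace J q} {V : Set M'} (ht : IsSmoothFieldOn t V) :
    IsSmoothAlongOn I J f (fun y => t (f y)) (f ⁻¹' V) :=
  ContMDiffOn.comp ht hf.contMDiffOn fun _ hy => hy

theorem IsSmoothAlongOn.congr_of_eventuallyEq {f : M → M'}
    {σ τ : ∀ y : M, TangentSpace J (f y)} {x : M}
    (hσ : ContMDiffAt I J.tangent ∞ (fun y => (⟨f y, σ y⟩ : TangentBundle J M')) x)
    (h : ∀ᶠ y in 𝓝 x, τ y = σ y) :
    ContMDiffAt I J.tangent ∞ (fun y => (⟨f y, τ y⟩ : TangentBundle J M')) x :=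
  hσ.congr_of_eventuallyEq (h.mono fun y hy => by
    change (⟨f y, τ y⟩ : TangentBundle J M') = ⟨f y, σ y⟩
    rw [hy])

theorem eventually_covAlong_eq
    (cov : CovariantDerivative J E' (TangentSpace J : M' → Type _)) {f : M → M'}
    (hf : ContMDiff I J ∞ f) {x : M} {σ : ∀ y : M, TangentSpace J (f y)}
    {t : ∀ q : M', TangentSpace J q} {V : Set M'} (hV : IsOpen V) (hx : f x ∈ V)
    (ht : IsSmoothFieldOn t V) (hσ : ∀ᶠ y in 𝓝 x, σ y = t (f y)) :
    ∀ᶠ y in 𝓝 x, ∀ v, covAlong cov f σ y v = cov t (f y) (mfderiv I J f y v) := by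
  filter_upwards [hσ.eventually_nhds, hf.continuous.continuousAt.eventually (hV.mem_nhds hx)]
    with y hy hyV v
  exact covAlong_eq_of_eventuallyEq cov (hf.mdifferentiable (by simp) y)
    (ht.mdifferentiableAt hV hyV) hy v

/-- Lie brackets of related vector fields are related. -/
theorem mfderiv_mlieBracket_of_related [I.Boundaryless] [J.Boundaryless] {f : M → M'}
    (hf : ContMDiff I J ∞ f) {x : M} {X Y : ∀ y : M, TangentSpace I y}
    {S T : ∀ q : M', TangentSpace J q}
    (hX : MDifferentiableAt I I.tangent (fun y => (⟨y, X y⟩ : TangentBundle I M)) x)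
    (hY : MDifferentiableAt I I.tangent (fun y => (⟨y, Y y⟩ : TangentBundle I M)) x)
    (hS : MDifferentiableAt J J.tangent (fun q => (⟨q, S q⟩ : TangentBundle J M')) (f x))
    (hT : MDifferentiableAt J J.tangent (fun q => (⟨q, T q⟩ : TangentBundle J M')) (f x))
    (hXS : ∀ᶠ y in 𝓝 x, mfderiv I J f y (X y) = S (f y))
    (hYT : ∀ᶠ y in 𝓝 x, mfderiv I J f y (Y y) = T (f y)) :
    mfderiv I J f x (mlieBracket I X Y x) = mlieBracket J S T (f x) := by
  have : IsManifold I 2 M := inferInstance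
  have : IsManifold J 2 M' := inferInstance
  have : CompleteSpace E := FiniteDimensional.complete ℝ E
  have : CompleteSpace E' := FiniteDimensional.complete ℝ E'
  -- The two brackets are compared as derivations of the vector-valued function `ψ`. This suffices
  -- because the differential of a chart is injective.
  let ψ : M' → E' := fun q => extChartAt J (f x) q
  have hψ2 : ContMDiffAt J 𝓘(ℝ, E') 2 ψ (f x) := contMDiffAt_extChartAt
  have hψd : ∀ᶠ q in 𝓝 (f x), MDifferentiableAt J 𝓘(ℝ, E') ψ q :=
    ((contMDiffAt_iff_contMDiffAt_nhds (by simp)).1 hψ2).mono fun y hy =>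
      hy.mdifferentiableAt two_ne_zero
  have hfd : MDifferentiable I J f := hf.mdifferentiable (by simp)
  have hinj : Function.Injective (mvfderiv J ψ (f x)) :=
    (isInvertible_mfderiv_extChartAt (mem_extChartAt_source (I := J) (f x))).injective
  apply hinj
  have key : ∀ (Z : ∀ y : M, TangentSpace I y) (W : ∀ q : M', TangentSpace J q),
      (∀ᶠ y in 𝓝 x, mfderiv I J f y (Z y) = W (f y)) →
      (fun y => mvfderiv I (fun z => ψ (f z)) y (Z y)) =ᶠ[𝓝 x] fun y => mvfderiv J ψ (f y) (W (f y)) := by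
    intro Z W hZW
    filter_upwards [hZW, hf.continuous.continuousAt.eventually hψd] with y hy hyd
    rw [mvfderiv_comp_eq hyd (hfd y), hy]
  have hψf : ContMDiffAt I 𝓘(ℝ, E') 2 (fun z => ψ (f z)) x :=
    hψ2.comp x ((hf x).of_le ENat.LEInfty.out)
  rw [mvfderiv_mlieBracket hψ2 hS hT, ← mvfderiv_comp_eq hψd.self_of_nhds (hfd x),
    mvfderiv_mlieBracket hψf hX hY, mvfderiv_congr (key X S hXS), mvfderiv_congr (key Y T hYT),
    mvfderiv_comp_eq (g := fun q => mvfderiv J ψ q (T q))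
      (mdifferentiableAt_mvfderiv_apply hψ2 hT) (hfd x),
    mvfderiv_comp_eq (g := fun q => mvfderiv J ψ q (S q))
      (mdifferentiableAt_mvfderiv_apply hψ2 hS) (hfd x),
    hXS.self_of_nhds, hYT.self_of_nhds]

variable [RiemannianBundle (fun x : M => TangentSpace I x)]
  [IsContMDiffRiemannianBundle I ∞ E (fun x : M => TangentSpace I x)]
  [RiemannianBundle (fun y : M' => TangentSpace J y)]
  [IsContMDiffRiemannianBundle J ∞ E' (fun y : M' => TangentSpace J y)]

theorem mdifferentiableAt_inner {X Y : ∀ x : M, TangentSpace I x} {x : M}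
    (hX : MDifferentiableAt I I.tangent (fun y => (⟨y, X y⟩ : TangentBundle I M)) x)
    (hY : MDifferentiableAt I I.tangent (fun y => (⟨y, Y y⟩ : TangentBundle I M)) x) :
    MDifferentiableAt I 𝓘(ℝ) (fun y => inner ℝ (X y) (Y y)) x :=
  MDifferentiableAt.inner_bundle (IB := I) (F := E) (E := fun y : M => TangentSpace I y)
    (b := fun y => y) hX hY

theorem IsLeviCivita.isSmoothFieldOn_nabla
    {cov : CovariantDerivative I E (TangentSpace I : M → Type _)} (hcov : IsLeviCivita cov)
    {X Y : ∀ x : M, TangentSpace I x} {U : Set M} (hU : IsOpen U)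
    (hX : IsSmoothFieldOn X U) (hY : IsSmoothFieldOn Y U) :
    IsSmoothFieldOn (nabla cov X Y) U := by
  have h1 := (hcov.smooth U hU).contMDiff (σ := Y) hY
  exact ContMDiffOn.clm_bundle_apply (n := ∞) (b := id) h1 hX

theorem IsLeviCivita.cov_sub_cov
    {cov : CovariantDerivative I E (TangentSpace I : M → Type _)} (hcov : IsLeviCivita cov)
    {X Y : ∀ x : M, TangentSpace I x} {x : M}
    (hX : MDifferentiableAt I I.tangent (fun y => (⟨y, X y⟩ : TangentBundle I M)) x)
    (hY : MDifferentiableAt I I.tangent (fun y => (⟨y, Y y⟩ : TangentBundle I M)) x) :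
    cov Y x (X x) - cov X x (Y x) = mlieBracket I X Y x :=
  cov.torsion_eq_zero_iff.1 hcov.torsion_eq_zero hX hY

theorem IsOrientedImmersion.injective {f : M → M'} {ν : ∀ x : M, TangentSpace J (f x)}
    (hf : IsOrientedImmersion I f ν) (x : M) : Function.Injective (mfderiv I J f x) := by
  refine (injective_iff_map_eq_zero (mfderiv I J f x)).2 fun v hv => ?_
  have h := hf.isometric x v v
  rw [hv, inner_zero_left] at h
  exact inner_self_eq_zero.1 h.symm

section AlongFacts

variable [I.Boundaryless]
  {cov : CovariantDerivative J E' (TangentSpace J : M' → Type _)} (hcov : IsLeviCivita cov)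
  {f : M → M'} {ν : ∀ x : M, TangentSpace J (f x)} (hf : IsOrientedImmersion I f ν)
  {U : Set M} (hU : IsOpen U)

include hcov hf hU

/-- Both fields are replaced near `x` by ambient fields composed with `f`, and the ambient identity
is applied to those. The next lemmas use the same device. -/
theorem mvfderiv_inner_along {x : M} (hx : x ∈ U) {σ τ : ∀ y : M, TangentSpace J (f y)}
    (hσ : IsSmoothAlongOn I J f σ U) (hτ : IsSmoothAlongOn I J f τ U) (v : TangentSpace I x) :
    mvfderiv I (fun y => inner ℝ (σ y) (τ y)) x v =
      inner ℝ (covAlong cov f σ x v) (τ x) + inner ℝ (σ x) (covAlong cov f τ x v) := by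
  obtain ⟨s, V, hV, hxV, hs, hσs⟩ := hσ.exists_extension hf.smooth (hf.injective x) hU hx
  obtain ⟨t, W, hW, hxW, ht, hτt⟩ := hτ.exists_extension hf.smooth (hf.injective x) hU hx
  have hfd := hf.smooth.mdifferentiable (by simp) x
  have hsd := hs.mdifferentiableAt hV hxV
  have htd := ht.mdifferentiableAt hW hxW
  rw [covAlong_eq_of_eventuallyEq cov hfd hsd hσs, covAlong_eq_of_eventuallyEq cov hfd htd hτt,
    hσs.self_of_nhds, hτt.self_of_nhds, ← hcov.metric _ s t hsd htd,
    ← mvfderiv_comp_eq (mdifferentiableAt_inner hsd htd) hfd]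
  refine mvfderiv_congr ?_ v
  filter_upwards [hσs, hτt] with y hy hy'
  rw [hy, hy']

theorem isSmoothAlongOn_covAlong {σ : ∀ y : M, TangentSpace J (f y)}
    (hσ : IsSmoothAlongOn I J f σ U) {X : ∀ y : M, TangentSpace I y} (hX : IsSmoothFieldOn X U) :
    IsSmoothAlongOn I J f (fun y => covAlong cov f σ y (X y)) U := by
  intro x hx
  obtain ⟨s, V, hV, hxV, hs, hσs⟩ := hσ.exists_extension hf.smooth (hf.injective x) hU hx
  obtain ⟨t, W, hW, hxW, ht, hXt⟩ := (isSmoothAlongOn_mfderiv hf.smooth hX).exists_extension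
    hf.smooth (hf.injective x) hU hx
  have h1 := hcov.isSmoothFieldOn_nabla (hV.inter hW) (ht.mono inter_subset_right)
    (hs.mono inter_subset_left)
  have h2 := (h1.comp_isSmoothAlongOn hf.smooth).contMDiffAt
    (((hV.inter hW).preimage hf.smooth.continuous).mem_nhds ⟨hxV, hxW⟩)
  refine (IsSmoothAlongOn.congr_of_eventuallyEq h2 ?_).contMDiffWithinAt
  filter_upwards [eventually_covAlong_eq cov hf.smooth hV hxV hs hσs, hXt] with y hy hy'
  rw [hy, hy']
  rfl

theorem covAlong_mfderiv_sub [J.Boundaryless] {x : M} (hx : x ∈ U) {X Y : ∀ y : M, TangentSpace I y}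
    (hX : IsSmoothFieldOn X U) (hY : IsSmoothFieldOn Y U) :
    covAlong cov f (fun y => mfderiv I J f y (Y y)) x (X x) -
      covAlong cov f (fun y => mfderiv I J f y (X y)) x (Y x) =
      mfderiv I J f x (mlieBracket I X Y x) := by
  obtain ⟨s, V, hV, hxV, hs, hXs⟩ := (isSmoothAlongOn_mfderiv hf.smooth hX).exists_extension
    hf.smooth (hf.injective x) hU hx
  obtain ⟨t, W, hW, hxW, ht, hYt⟩ := (isSmoothAlongOn_mfderiv hf.smooth hY).exists_extension
    hf.smooth (hf.injective x) hU hx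
  have hfd := hf.smooth.mdifferentiable (by simp) x
  have hsd := hs.mdifferentiableAt hV hxV
  have htd := ht.mdifferentiableAt hW hxW
  rw [covAlong_eq_of_eventuallyEq cov hfd hsd hXs, covAlong_eq_of_eventuallyEq cov hfd htd hYt,
    mfderiv_mlieBracket_of_related hf.smooth (hX.mdifferentiableAt hU hx)
      (hY.mdifferentiableAt hU hx) hsd htd hXs hYt, hXs.self_of_nhds, hYt.self_of_nhds,
    hcov.cov_sub_cov hsd htd]

/-- The curvature of the pulled back connection vanishes on the normal field. -/
theorem covAlong_covAlong_sub [J.Boundaryless] {c : ℝ} (hc : HasConstantCurvature cov c)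
    {x : M} (hx : x ∈ U) {X Y : ∀ y : M, TangentSpace I y}
    (hX : IsSmoothFieldOn X U) (hY : IsSmoothFieldOn Y U) :
    covAlong cov f (fun y => covAlong cov f ν y (Y y)) x (X x) -
      covAlong cov f (fun y => covAlong cov f ν y (X y)) x (Y x) -
      covAlong cov f ν x (mlieBracket I X Y x) = 0 := by
  have hν : IsSmoothAlongOn I J f ν U := hf.smooth_normal.contMDiffOn
  obtain ⟨s, V, hV, hxV, hs, hXs⟩ := (isSmoothAlongOn_mfderiv hf.smooth hX).exists_extension
    hf.smooth (hf.injective x) hU hx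
  obtain ⟨t, W, hW, hxW, ht, hYt⟩ := (isSmoothAlongOn_mfderiv hf.smooth hY).exists_extension
    hf.smooth (hf.injective x) hU hx
  obtain ⟨n, O, hO, hxO, hn, hνn⟩ := hν.exists_extension hf.smooth (hf.injective x) hU hx
  have hVWO : IsOpen (V ∩ W ∩ O) := (hV.inter hW).inter hO
  have hxVWO : f x ∈ V ∩ W ∩ O := ⟨⟨hxV, hxW⟩, hxO⟩
  replace hs : IsSmoothFieldOn s (V ∩ W ∩ O) := hs.mono fun _ h => h.1.1
  replace ht : IsSmoothFieldOn t (V ∩ W ∩ O) := ht.mono fun _ h => h.1.2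
  replace hn : IsSmoothFieldOn n (V ∩ W ∩ O) := hn.mono fun _ h => h.2
  have hfd := hf.smooth.mdifferentiable (by simp) x
  have hsd := hs.mdifferentiableAt hVWO hxVWO
  have htd := ht.mdifferentiableAt hVWO hxVWO
  have hev := eventually_covAlong_eq cov hf.smooth hVWO hxVWO hn hνn
  have h1 : ∀ᶠ y in 𝓝 x, covAlong cov f ν y (X y) = nabla cov s n (f y) := by
    filter_upwards [hev, hXs] with y hy hy'
    rw [hy, hy']
    rfl
  have h2 : ∀ᶠ y in 𝓝 x, covAlong cov f ν y (Y y) = nabla cov t n (f y) := by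
    filter_upwards [hev, hYt] with y hy hy'
    rw [hy, hy']
    rfl
  -- Both terms of the constant curvature formula contain an inner product of a tangent vector with
  -- `ν`, so the right-hand side is zero.
  have hR := hc _ hVWO s t n hs ht hn (f x) hxVWO
  rw [← hXs.self_of_nhds, ← hYt.self_of_nhds, ← hνn.self_of_nhds,
    real_inner_comm, hf.orthogonal, real_inner_comm, hf.orthogonal] at hR
  simp only [zero_smul, sub_zero, smul_zero] at hR
  rw [← hR, covAlong_eq_of_eventuallyEq cov hfd
      ((hcov.isSmoothFieldOn_nabla hVWO hs hn).mdifferentiableAt hVWO hxVWO) h1,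
    covAlong_eq_of_eventuallyEq cov hfd
      ((hcov.isSmoothFieldOn_nabla hVWO ht hn).mdifferentiableAt hVWO hxVWO) h2,
    hev.self_of_nhds,
    mfderiv_mlieBracket_of_related hf.smooth (hX.mdifferentiableAt hU hx)
      (hY.mdifferentiableAt hU hx) hsd htd hXs hYt, hXs.self_of_nhds, hYt.self_of_nhds]
  rfl

end AlongFacts

end Immersion

/-! ### Smooth fields of endomorphisms and their covariant derivative. -/

section EndomorphismField

set_option linter.unusedSectionVars false

variable
  {E : Type*} [NormedAddCommGroup E] [NormedSpace ℝ E] [FiniteDimensional ℝ E]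
  {H : Type*} [TopologicalSpace H] {I : ModelWithCorners ℝ E H}
  {M : Type*} [TopologicalSpace M] [ChartedSpace H M] [IsManifold I ∞ M]

/-- A field of endomorphisms of the tangent spaces is smooth if it maps smooth vector fields to
smooth vector fields. -/
def IsSmoothEndField (B : ∀ x : M, TangentSpace I x →L[ℝ] TangentSpace I x) : Prop :=
  ∀ (U : Set M) (X : ∀ x : M, TangentSpace I x), IsOpen U → IsSmoothFieldOn X U →
    IsSmoothFieldOn (fun x => B x (X x)) U

/-- Smoothness of `B` is tested on smooth fields, while the tensoriality argument in
`covDerivEnd_eq` involves fields differentiable at one point only. Expanding such a field in a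
smooth local frame bridges the gap. -/
theorem IsSmoothEndField.mdifferentiableAt
    {B : ∀ x : M, TangentSpace I x →L[ℝ] TangentSpace I x} (hB : IsSmoothEndField B)
    {x : M} {Y : ∀ y : M, TangentSpace I y}
    (hY : MDifferentiableAt I I.tangent (fun y => (⟨y, Y y⟩ : TangentBundle I M)) x) :
    MDifferentiableAt I I.tangent (fun y => (⟨y, B y (Y y)⟩ : TangentBundle I M)) x := by
  have hcs : CompleteSpace E := FiniteDimensional.complete ℝ E
  set t := trivializationAt E (TangentSpace I : M → Type _) x with ht
  have hx : x ∈ t.baseSet := FiberBundle.mem_baseSet_trivializationAt E (TangentSpace I : M → Type _) x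
  let b := Module.finBasis ℝ E
  have hs : ∀ i, IsSmoothFieldOn (t.localFrame b i) t.baseSet := fun i =>
    t.contMDiffOn_localFrame_baseSet (I := I) (n := ∞) b i
  have hBs : ∀ i, MDifferentiableAt I I.tangent
      (fun y => (⟨y, B y (t.localFrame b i y)⟩ : TangentBundle I M)) x := fun i =>
    (hB _ _ t.open_baseSet (hs i)).mdifferentiableAt t.open_baseSet hx
  have hc : ∀ i, MDifferentiableAt I 𝓘(ℝ) (LinearMap.piApply (t.localFrameCoeff I b i) Y) x :=
    fun i => mdifferentiableAt_localFrameCoeff b hx hY i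
  have hsum : MDifferentiableAt I I.tangent (fun y => (⟨y, ∑ i,
      (LinearMap.piApply (t.localFrameCoeff I b i) Y) y • B y (t.localFrame b i y)⟩ :
        TangentBundle I M)) x :=
    MDifferentiableAt.sum_section fun i _ => (hc i).smul_section (hBs i)
  refine hsum.congr_of_eventuallyEq ?_
  filter_upwards [t.eventually_eq_localFrame_sum_coeff_smul (I := I) b hx (s := Y)] with y hy
  have : B y (Y y) = ∑ i,
      (LinearMap.piApply (t.localFrameCoeff I b i) Y) y • B y (t.localFrame b i y) := by
    conv_lhs => rw [hy]
    rw [map_sum]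
    exact Finset.sum_congr rfl fun i _ => map_smul _ _ _
  rw [this]

/-- `(∇_v B) Y = ∇_v (B Y) - B (∇_v Y)` for every differentiable vector field `Y`. -/
theorem covDerivEnd_eq {cov : CovariantDerivative I E (TangentSpace I : M → Type _)}
    {B : ∀ x : M, TangentSpace I x →L[ℝ] TangentSpace I x} (hB : IsSmoothEndField B)
    {x : M} {Y : ∀ y : M, TangentSpace I y}
    (hY : MDifferentiableAt I I.tangent (fun y => (⟨y, Y y⟩ : TangentBundle I M)) x)
    (v : TangentSpace I x) :
    covDerivEnd cov B x v (Y x) = cov (fun y => B y (Y y)) x v - B x (cov Y x v) := by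
  -- Replacing `Y` by `g Y` adds `dg(v) B Y` to both terms, so the difference is tensorial.
  let Ψ : (∀ y : M, TangentSpace I y) → TangentSpace I x := fun Y =>
    cov (fun y => B y (Y y)) x v - B x (cov Y x v)
  have hΨ : TensorialAt I E Ψ x := by
    refine ⟨fun {g σ} hg hσ => ?_, fun {σ σ'} hσ hσ' => ?_⟩
    · have h1 : (fun y => B y ((g • σ) y)) = g • fun y => B y (σ y) :=
        funext fun y => map_smul (B y) (g y) (σ y)
      simp only [Ψ]
      rw [h1, cov.isCovariantDerivativeOnUniv.leibniz hσ hg,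
        cov.isCovariantDerivativeOnUniv.leibniz (hB.mdifferentiableAt hσ) hg]
      simp only [add_apply, smul_apply, ContinuousLinearMap.smulRight_apply,
        map_add, map_smul, smul_sub]
      abel
    · have h1 : (fun y => B y ((σ + σ') y)) = (fun y => B y (σ y)) + fun y => B y (σ' y) :=
        funext fun y => map_add (B y) (σ y) (σ' y)
      simp only [Ψ]
      rw [h1, cov.isCovariantDerivativeOnUniv.add hσ hσ',
        cov.isCovariantDerivativeOnUniv.add (hB.mdifferentiableAt hσ) (hB.mdifferentiableAt hσ')]
      simp only [add_apply, map_add]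
      abel
  exact hΨ.pointwise (FiberBundle.mdifferentiableAt_extend I E (Y x)) hY
    (FiberBundle.extend_apply_self E (Y x))

end EndomorphismField

/-! ### The shape operator, the Gauss and Weingarten formulas, and the Codazzi equation. -/

section ShapeOperator

set_option linter.unusedSectionVars false

/-- A dimension count: if `u` were nonzero, the range of `T` together with `n` and `u` would have
dimension exceeding that of `W` by one. -/
theorem eq_zero_of_orthogonal_range {V W : Type*} [NormedAddCommGroup V] [InnerProductSpace ℝ V]
    [FiniteDimensional ℝ V] [NormedAddCommGroup W] [InnerProductSpace ℝ W] [FiniteDimensional ℝ W]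
    (hdim : Module.finrank ℝ W = Module.finrank ℝ V + 1) (T : V →L[ℝ] W)
    (hT : ∀ v w, inner ℝ (T v) (T w) = (inner ℝ v w : ℝ)) {n u : W}
    (hn : inner ℝ n n = (1 : ℝ)) (hnT : ∀ v, inner ℝ n (T v) = (0 : ℝ))
    (huT : ∀ v, inner ℝ u (T v) = (0 : ℝ)) (hun : inner ℝ u n = (0 : ℝ)) : u = 0 := by
  by_contra hu
  let S : V × ℝ × ℝ →ₗ[ℝ] W := (T : V →ₗ[ℝ] W).coprod
    ((LinearMap.toSpanSingleton ℝ W n).coprod (LinearMap.toSpanSingleton ℝ W u))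
  have hS : ∀ v a b, S (v, a, b) = T v + (a • n + b • u) := fun v a b => by simp [S]
  have hinj : Function.Injective S := by
    refine (injective_iff_map_eq_zero S).2 ?_
    rintro ⟨v, a, b⟩ h
    rw [hS] at h
    have h1 := congrArg (fun z => (inner ℝ u z : ℝ)) h
    have h2 := congrArg (fun z => (inner ℝ n z : ℝ)) h
    have h3 := congrArg (fun z => (inner ℝ (T v) z : ℝ)) h
    simp only [inner_add_right, inner_smul_right, huT, hun, hnT, hn, inner_zero_right,
      real_inner_comm u n, hT, real_inner_comm n (T v), real_inner_comm u (T v)] at h1 h2 h3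
    have huu : (inner ℝ u u : ℝ) ≠ 0 := fun h0 => hu (inner_self_eq_zero.1 h0)
    have hb : b = 0 := by
      rcases mul_eq_zero.1 (by linarith : b * (inner ℝ u u : ℝ) = 0) with h | h
      · exact h
      · exact absurd h huu
    have ha : a = 0 := by linarith
    have hv : v = 0 := inner_self_eq_zero.1 (by linarith : (inner ℝ v v : ℝ) = 0)
    simp [ha, hb, hv]
  have := LinearMap.finrank_le_finrank_of_injective hinj
  simp only [Module.finrank_prod, Module.finrank_self] at this
  omega

variable
  {E : Type*} [NormedAddCommGroup E] [NormedSpace ℝ E] [FiniteDimensional ℝ E]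
  {H : Type*} [TopologicalSpace H] {I : ModelWithCorners ℝ E H} [I.Boundaryless]
  {M : Type*} [TopologicalSpace M] [ChartedSpace H M] [IsManifold I ∞ M]
  {E' : Type*} [NormedAddCommGroup E'] [NormedSpace ℝ E'] [FiniteDimensional ℝ E']
  {H' : Type*} [TopologicalSpace H'] {J : ModelWithCorners ℝ E' H'} [J.Boundaryless]
  {M' : Type*} [TopologicalSpace M'] [ChartedSpace H' M'] [IsManifold J ∞ M']

/-- A vector field with smooth image under the differential of an immersion is smooth. -/
theorem isSmoothFieldOn_of_mfderiv {f : M → M'} (hf : ContMDiff I J ∞ f)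
    (hinj : ∀ x, Function.Injective (mfderiv I J f x)) {W : ∀ x : M, TangentSpace I x} {U : Set M}
    (hU : IsOpen U) (hW : IsSmoothAlongOn I J f (fun y => mfderiv I J f y (W y)) U) :
    IsSmoothFieldOn W U := by
  intro x hx
  have : CompleteSpace E := FiniteDimensional.complete ℝ E
  obtain ⟨r, V, hV, hxV, hr, hleft⟩ := exists_contMDiffOn_local_leftInverse hf (hinj x)
  -- With `r` a smooth local left inverse of `f`, the field is recovered as `W = dr (df W)`, a
  -- composition of smooth maps.
  have h1 := hr.contMDiffOn_tangentMapWithin (m := ∞) (by simp) hV.uniqueMDiffOn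
  have h2 : ContMDiffOn I I.tangent ∞ (fun y => tangentMapWithin J I r V
      (⟨f y, mfderiv I J f y (W y)⟩ : TangentBundle J M')) (U ∩ f ⁻¹' V) :=
    h1.comp (hW.mono inter_subset_left) fun y hy => hy.2
  have hUV : IsOpen (U ∩ f ⁻¹' V) := hU.inter (hV.preimage hf.continuous)
  refine ((h2.contMDiffAt (hUV.mem_nhds ⟨hx, hxV⟩)).congr_of_eventuallyEq ?_).contMDiffWithinAt
  filter_upwards [hleft.eventually_nhds, hUV.mem_nhds ⟨hx, hxV⟩] with y hy hyU
  have hrd : MDifferentiableAt J I r (f y) :=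
    (hr.contMDiffAt (hV.mem_nhds hyU.2)).mdifferentiableAt (by simp)
  have h3 : tangentMapWithin J I r V (⟨f y, mfderiv I J f y (W y)⟩ : TangentBundle J M') =
      tangentMap J I r (tangentMap I J f (⟨y, W y⟩ : TangentBundle I M)) := by
    exact tangentMapWithin_eq_tangentMap
      (p := (⟨f y, mfderiv I J f y (W y)⟩ : TangentBundle J M')) (hV.uniqueMDiffOn (f y) hyU.2) hrd
  rw [h3, ← tangentMap_comp_at (⟨y, W y⟩ : TangentBundle I M) hrd (hf.mdifferentiable (by simp) y)]
  have h4 : mfderiv I I (r ∘ f) y = mfderiv I I id y :=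
    EventuallyEq.mfderiv_eq (f₁ := r ∘ f) (f := id) hy
  have h5 : ∀ z (w : E), z = y → w = W y → (⟨y, W y⟩ : TangentBundle I M) = ⟨z, w⟩ := by
    rintro _ _ rfl rfl
    rfl
  refine h5 (r (f y)) (mfderiv I I (r ∘ f) y (W y)) hy.self_of_nhds ?_
  have h6 := congrArg (fun T : E →L[ℝ] E => T (W y)) h4
  refine h6.trans ?_
  change mfderiv I I id y (W y) = W y
  rw [mfderiv_id]
  rfl

variable [RiemannianBundle (fun x : M => TangentSpace I x)]
  [IsContMDiffRiemannianBundle I ∞ E (fun x : M => TangentSpace I x)]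
  [RiemannianBundle (fun y : M' => TangentSpace J y)]
  [IsContMDiffRiemannianBundle J ∞ E' (fun y : M' => TangentSpace J y)]
  {cov' : CovariantDerivative J E' (TangentSpace J : M' → Type _)} (hcov' : IsLeviCivita cov')
  {f : M → M'} {ν : ∀ x : M, TangentSpace J (f x)} (hf : IsOrientedImmersion I f ν)

theorem inner_shapeOperator (cov' : CovariantDerivative J E' (TangentSpace J : M' → Type _))
    (f : M → M') (ν : ∀ x : M, TangentSpace J (f x)) (x : M) (v w : TangentSpace I x) :
    inner ℝ (shapeOperator cov' f ν x v) w =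
      -(inner ℝ (covAlong cov' f ν x v) (mfderiv I J f x w) : ℝ) := by
  have h1 : shapeOperator cov' f ν x v =
    -(ContinuousLinearMap.adjoint (mfderiv I J f x) (covAlong cov' f ν x v)) := rfl
  rw [h1, inner_neg_left, ContinuousLinearMap.adjoint_inner_left]

include hcov' hf

theorem inner_covAlong_normal (x : M) (v : TangentSpace I x) :
    inner ℝ (covAlong cov' f ν x v) (ν x) = (0 : ℝ) := by
  have hν : IsSmoothAlongOn I J f ν univ := hf.smooth_normal.contMDiffOn
  have h := mvfderiv_inner_along hcov' hf isOpen_univ (mem_univ x) hν hν v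
  have h2 : mvfderiv I (fun y => (inner ℝ (ν y) (ν y) : ℝ)) x v = 0 := by
    rw [mvfderiv_congr (Eventually.of_forall hf.norm_normal) v, mvfderiv_const]
    rfl
  rw [h2, real_inner_comm (covAlong cov' f ν x v) (ν x)] at h
  linarith

/-- The derivative of `ν` is orthogonal to `ν`, because `ν` has constant length, and in codimension
one it is then tangent. Hence the adjoint used in the shape operator loses no information. -/
theorem mfderiv_shapeOperator (hdim : Module.finrank ℝ E' = Module.finrank ℝ E + 1)
    (x : M) (v : TangentSpace I x) :
    mfderiv I J f x (shapeOperator cov' f ν x v) = -covAlong cov' f ν x v := by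
  have h := eq_zero_of_orthogonal_range (V := TangentSpace I x) (W := TangentSpace J (f x))
    hdim (mfderiv I J f x) (hf.isometric x) (hf.norm_normal x) (hf.orthogonal x)
    (u := mfderiv I J f x (shapeOperator cov' f ν x v) + covAlong cov' f ν x v) ?_ ?_
  · exact eq_neg_of_add_eq_zero_left h
  · intro w
    rw [inner_add_left, hf.isometric, inner_shapeOperator]
    ring
  · rw [inner_add_left, real_inner_comm, hf.orthogonal, inner_covAlong_normal hcov' hf]
    ring

/-- By the Weingarten formula `df (A X) = -∇̄_X ν`, which is smooth along `f`. Since `f` is an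
immersion, `A X` itself is smooth. -/
theorem isSmoothEndField_shapeOperator (hdim : Module.finrank ℝ E' = Module.finrank ℝ E + 1) :
    IsSmoothEndField (shapeOperator (I := I) cov' f ν) := by
  intro U X hU hX
  have hν : IsSmoothAlongOn I J f ν U := hf.smooth_normal.contMDiffOn
  have h1 := isSmoothAlongOn_covAlong hcov' hf hU hν
    (X := fun y => -X y) (fun x hx => ContMDiffWithinAt.neg_section (hX x hx))
  refine isSmoothFieldOn_of_mfderiv hf.smooth hf.injective hU (h1.congr fun y _ => ?_)
  change (⟨f y, mfderiv I J f y (shapeOperator cov' f ν y (X y))⟩ : TangentBundle J M') =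
    ⟨f y, covAlong cov' f ν y (-X y)⟩
  rw [mfderiv_shapeOperator hcov' hf hdim, map_neg]

/-- Obtained by differentiating `⟨ν, df Y⟩ = 0`. -/
theorem inner_shapeOperator_eq {U : Set M} (hU : IsOpen U) {x : M} (hx : x ∈ U)
    {Y : ∀ y : M, TangentSpace I y} (hY : IsSmoothFieldOn Y U) (v : TangentSpace I x) :
    inner ℝ (shapeOperator cov' f ν x v) (Y x) =
      (inner ℝ (ν x) (covAlong cov' f (fun y => mfderiv I J f y (Y y)) x v) : ℝ) := by
  have hν : IsSmoothAlongOn I J f ν U := hf.smooth_normal.contMDiffOn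
  have h := mvfderiv_inner_along hcov' hf hU hx hν (isSmoothAlongOn_mfderiv hf.smooth hY) v
  have h2 : mvfderiv I (fun y => (inner ℝ (ν y) (mfderiv I J f y (Y y)) : ℝ)) x v = 0 := by
    rw [mvfderiv_congr (Eventually.of_forall fun y => hf.orthogonal y (Y y)) v, mvfderiv_const]
    rfl
  rw [h2] at h
  rw [inner_shapeOperator]
  linarith

/-- By absence of torsion, the difference of the two sides is, up to sign, `⟨ν, df [X, Y]⟩`, which
vanishes. -/
theorem shapeOperator_symmetric (x : M) (v w : TangentSpace I x) :
    inner ℝ (shapeOperator cov' f ν x v) w = (inner ℝ v (shapeOperator cov' f ν x w) : ℝ) := by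
  obtain ⟨U, hU, hxU, hX⟩ := isSmoothFieldOn_extend x v
  obtain ⟨V, hV, hxV, hY⟩ := isSmoothFieldOn_extend x w
  set X : ∀ y : M, TangentSpace I y := FiberBundle.extend E v with hXd
  set Y : ∀ y : M, TangentSpace I y := FiberBundle.extend E w with hYd
  have hXx : X x = v := FiberBundle.extend_apply_self E v
  have hYx : Y x = w := FiberBundle.extend_apply_self E w
  have hUV := hU.inter hV
  replace hX : IsSmoothFieldOn X (U ∩ V) := hX.mono inter_subset_left
  replace hY : IsSmoothFieldOn Y (U ∩ V) := hY.mono inter_subset_right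
  have h1 := covAlong_mfderiv_sub hcov' hf hUV ⟨hxU, hxV⟩ hX hY
  have h2 := inner_shapeOperator_eq hcov' hf hUV ⟨hxU, hxV⟩ hX (Y x)
  have h3 := inner_shapeOperator_eq hcov' hf hUV ⟨hxU, hxV⟩ hY (X x)
  have h4 := hf.orthogonal x (mlieBracket I X Y x)
  rw [← h1, inner_sub_right, ← h2, ← h3, hXx, hYx, real_inner_comm v] at h4
  linarith

variable {cov : CovariantDerivative I E (TangentSpace I : M → Type _)} (hcov : IsLeviCivita cov)

include hcov

/-- The tangential part of the connection along an isometric immersion is the Levi-Civita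
connection. -/
theorem inner_covAlong_mfderiv {U : Set M} (hU : IsOpen U) {x : M} (hx : x ∈ U)
    {X Y Z : ∀ y : M, TangentSpace I y} (hX : IsSmoothFieldOn X U) (hY : IsSmoothFieldOn Y U)
    (hZ : IsSmoothFieldOn Z U) :
    inner ℝ (covAlong cov' f (fun y => mfderiv I J f y (Y y)) x (X x)) (mfderiv I J f x (Z x)) =
      (inner ℝ (cov Y x (X x)) (Z x) : ℝ) := by
  -- The Koszul argument: `S` is symmetric in its first two arguments because neither connection has
  -- torsion, and skew in its last two because both are metric. Such a trilinear expression is zero.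
  let S : ∀ X Y Z : ∀ y : M, TangentSpace I y, ℝ := fun X Y Z =>
    inner ℝ (covAlong cov' f (fun y => mfderiv I J f y (Y y)) x (X x)) (mfderiv I J f x (Z x)) -
      inner ℝ (cov Y x (X x)) (Z x)
  have symm : ∀ {X Y Z : ∀ y : M, TangentSpace I y}, IsSmoothFieldOn X U → IsSmoothFieldOn Y U →
      S X Y Z = S Y X Z := by
    intro X Y Z hX hY
    have h1 := covAlong_mfderiv_sub hcov' hf hU hx hX hY
    rw [← hcov.cov_sub_cov (hX.mdifferentiableAt hU hx) (hY.mdifferentiableAt hU hx)] at h1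
    have h2 := congrArg (fun z => (inner ℝ z (mfderiv I J f x (Z x)) : ℝ)) h1
    simp only [hf.isometric, inner_sub_left] at h2
    simp only [S]
    linarith
  have skew : ∀ {X Y Z : ∀ y : M, TangentSpace I y}, IsSmoothFieldOn Y U → IsSmoothFieldOn Z U →
      S X Y Z = -S X Z Y := by
    intro X Y Z hY hZ
    have h1 := mvfderiv_inner_along hcov' hf hU hx (isSmoothAlongOn_mfderiv hf.smooth hY)
      (isSmoothAlongOn_mfderiv hf.smooth hZ) (X x)
    have h2 := hcov.metric x Y Z (hY.mdifferentiableAt hU hx) (hZ.mdifferentiableAt hU hx) (X x)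
    rw [mvfderiv_congr (Eventually.of_forall fun y => hf.isometric y (Y y) (Z y)) (X x), h2,
      real_inner_comm _ (mfderiv I J f x (Y x)), real_inner_comm _ (Y x)] at h1
    simp only [S]
    linarith
  have h : S X Y Z = -S X Y Z := by
    calc S X Y Z = S Y X Z := symm hX hY
      _ = -S Y Z X := skew hX hZ
      _ = -S Z Y X := by rw [symm hY hZ]
      _ = S Z X Y := by rw [skew hY hX, neg_neg]
      _ = S X Z Y := symm hZ hX
      _ = -S X Y Z := skew hZ hY
  have h0 : S X Y Z = 0 := by linarith
  exact sub_eq_zero.1 h0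

/-- The Codazzi equation for hypersurfaces of spaces of constant curvature. -/
theorem codazzi (hdim : Module.finrank ℝ E' = Module.finrank ℝ E + 1) {c : ℝ}
    (hc : HasConstantCurvature cov' c) (x : M) (v w : TangentSpace I x) :
    covDerivEnd cov (shapeOperator cov' f ν) x v w =
      covDerivEnd cov (shapeOperator cov' f ν) x w v := by
  set A : ∀ x : M, TangentSpace I x →L[ℝ] TangentSpace I x := shapeOperator cov' f ν with hA
  have hAs : IsSmoothEndField A := isSmoothEndField_shapeOperator hcov' hf hdim
  refine ext_inner_right ℝ fun z => ?_
  obtain ⟨U₁, hU₁, hx₁, hX⟩ := isSmoothFieldOn_extend x v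
  obtain ⟨U₂, hU₂, hx₂, hY⟩ := isSmoothFieldOn_extend x w
  obtain ⟨U₃, hU₃, hx₃, hZ⟩ := isSmoothFieldOn_extend x z
  set X : ∀ y : M, TangentSpace I y := FiberBundle.extend E v with hXd
  set Y : ∀ y : M, TangentSpace I y := FiberBundle.extend E w with hYd
  set Z : ∀ y : M, TangentSpace I y := FiberBundle.extend E z with hZd
  have hXx : X x = v := FiberBundle.extend_apply_self E v
  have hYx : Y x = w := FiberBundle.extend_apply_self E w
  have hZx : Z x = z := FiberBundle.extend_apply_self E z
  have hU : IsOpen (U₁ ∩ U₂ ∩ U₃) := (hU₁.inter hU₂).inter hU₃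
  have hx : x ∈ U₁ ∩ U₂ ∩ U₃ := ⟨⟨hx₁, hx₂⟩, hx₃⟩
  replace hX : IsSmoothFieldOn X (U₁ ∩ U₂ ∩ U₃) := hX.mono fun _ h => h.1.1
  replace hY : IsSmoothFieldOn Y (U₁ ∩ U₂ ∩ U₃) := hY.mono fun _ h => h.1.2
  replace hZ : IsSmoothFieldOn Z (U₁ ∩ U₂ ∩ U₃) := hZ.mono fun _ h => h.2
  have hXd := hX.mdifferentiableAt hU hx
  have hYd := hY.mdifferentiableAt hU hx
  -- The Codazzi equation is the tangential part of `R̄(X, Y)ν = 0`.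
  have h1 := covAlong_covAlong_sub hcov' hf hU hc hx hX hY
  -- The sign is put inside the argument of `A`, so that the inner covariant derivative of `ν` is
  -- `df` of a smooth field and `inner_covAlong_mfderiv` applies to it.
  have hν : ∀ (y : M) (u : TangentSpace I y), covAlong cov' f ν y u = mfderiv I J f y (A y (-u)) := by
    intro y u
    rw [hA, mfderiv_shapeOperator hcov' hf hdim, map_neg, neg_neg]
  have hneg : ∀ {W : ∀ y : M, TangentSpace I y}, IsSmoothFieldOn W (U₁ ∩ U₂ ∩ U₃) →
      IsSmoothFieldOn (fun y => -W y) (U₁ ∩ U₂ ∩ U₃) := fun hW x hx =>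
    ContMDiffWithinAt.neg_section (hW x hx)
  simp only [hν] at h1
  have h2 := congrArg (fun u => (inner ℝ u (mfderiv I J f x (Z x)) : ℝ)) h1
  simp only [inner_sub_left, inner_zero_left] at h2
  rw [inner_covAlong_mfderiv hcov' hf hcov hU hx hX (hAs _ _ hU (hneg hY)) hZ,
    inner_covAlong_mfderiv hcov' hf hcov hU hx hY (hAs _ _ hU (hneg hX)) hZ, hf.isometric,
    ← hcov.cov_sub_cov hXd hYd] at h2
  have hcn : ∀ {W : ∀ y : M, TangentSpace I y},
      MDifferentiableAt I I.tangent (fun y => (⟨y, W y⟩ : TangentBundle I M)) x → ∀ u,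
      cov (fun y => A y (-W y)) x u = -cov (fun y => A y (W y)) x u := by
    intro W hW u
    have h3 := cov.isCovariantDerivativeOnUniv.smul_const (-1 : ℝ) (hAs.mdifferentiableAt hW)
    have h4 : (fun y => A y (-W y)) = (-1 : ℝ) • fun y => A y (W y) :=
      funext fun y => by simp
    rw [h4, h3]
    simp
  rw [hcn hXd, hcn hYd] at h2
  have hX' := covDerivEnd_eq (cov := cov) hAs hXd w
  have hY' := covDerivEnd_eq (cov := cov) hAs hYd v
  rw [hXx] at hX'
  rw [hYx] at hY'
  rw [hX', hY', ← hZx, inner_sub_left, inner_sub_left]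
  rw [hXx, hYx] at h2
  simp only [map_neg, map_sub, inner_neg_left, inner_sub_left] at h2
  linarith

end ShapeOperator

/-! ### Spectral decomposition of a symmetric operator. -/

section LinearAlgebra

variable {V : Type*} [NormedAddCommGroup V] [InnerProductSpace ℝ V] {k : ℕ} {m : Fin k → ℝ}
  {T : V →L[ℝ] V} (hT : ∀ v w, inner ℝ (T v) w = (inner ℝ v (T w) : ℝ))

include hT

theorem exists_sum_eigenvectors_eq [FiniteDimensional ℝ V]
    (hm : ∀ r, Module.End.HasEigenvalue (T : V →ₗ[ℝ] V) r ↔ ∃ i, m i = r) (v : V) :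
    ∃ u : Fin k → V, (∀ i, T (u i) = m i • u i) ∧ ∑ i, u i = v := by
  have hs : (T : V →ₗ[ℝ] V).IsSymmetric := hT
  have h1 : ⨆ r, Module.End.eigenspace (T : V →ₗ[ℝ] V) r = ⊤ :=
    Submodule.orthogonal_eq_bot_iff.1 hs.orthogonalComplement_iSup_eigenspaces_eq_bot
  have hv : v ∈ ⨆ r, Module.End.eigenspace (T : V →ₗ[ℝ] V) r := h1 ▸ Submodule.mem_top
  refine Submodule.iSup_induction _
    (motive := fun v => ∃ u : Fin k → V, (∀ i, T (u i) = m i • u i) ∧ ∑ i, u i = v) hv ?_ ?_ ?_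
  · intro r w hw
    by_cases hw0 : w = 0
    · exact ⟨fun _ => 0, by simp, by simp [hw0]⟩
    · have hr : Module.End.HasEigenvalue (T : V →ₗ[ℝ] V) r :=
        Module.End.hasEigenvalue_of_hasEigenvector ⟨hw, hw0⟩
      obtain ⟨i, rfl⟩ := (hm r).1 hr
      have hw' : T w = m i • w := Module.End.mem_eigenspace_iff.1 hw
      refine ⟨fun j => if j = i then w else 0, fun j => ?_, by simp⟩
      by_cases hji : j = i <;> simp [hji, hw']
  · exact ⟨fun _ => 0, by simp, by simp⟩
  · rintro _ _ ⟨u, hu, rfl⟩ ⟨u', hu', rfl⟩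
    exact ⟨fun i => u i + u' i, fun i => by simp [hu, hu'], Finset.sum_add_distrib⟩

theorem inner_eigenvectors_eq_zero {a b : ℝ} (hab : a ≠ b) {v w : V} (hv : T v = a • v)
    (hw : T w = b • w) : inner ℝ v w = (0 : ℝ) := by
  have h := hT v w
  rw [hv, hw, inner_smul_left, inner_smul_right] at h
  have h' : (a - b) * (inner ℝ v w : ℝ) = 0 := by
    rw [sub_mul]; exact sub_eq_zero.2 h
  exact (mul_eq_zero.1 h').resolve_left (sub_ne_zero.2 hab)

/-- The quantities on the left are smooth in the base point when the operator and the vector are.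
The right side exhibits them as the moments of masses `|u_i|²` placed at the eigenvalues. -/
theorem inner_iterate_sum_eigenvectors (hm : Function.Injective m) {u : Fin k → V}
    (hu : ∀ i, T (u i) = m i • u i) (p : ℕ) :
    inner ℝ (T^[p] (∑ i, u i)) (∑ i, u i) = ∑ i, m i ^ p * (inner ℝ (u i) (u i) : ℝ) := by
  have h1 : T^[p] (∑ i, u i) = ∑ i, m i ^ p • u i := by
    induction p with
    | zero => simp
    | succ p ih =>
      rw [Function.iterate_succ_apply', ih, map_sum]
      exact Finset.sum_congr rfl fun i _ => by rw [map_smul, hu, smul_smul, pow_succ]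
  rw [h1, sum_inner]
  refine Finset.sum_congr rfl fun i _ => ?_
  rw [inner_sum, Finset.sum_eq_single i]
  · rw [inner_smul_left]; rfl
  · intro j _ hj
    rw [inner_smul_left, inner_eigenvectors_eq_zero hT (fun h => hj (hm h).symm) (hu i) (hu j), mul_zero]
  · simp

end LinearAlgebra

/-! ### Hankel operators of moment sequences. -/

section Moments

/-- The Hankel operator of a sequence. -/
def hankel (k : ℕ) (h : ℕ → ℝ) : (Fin k → ℝ) →L[ℝ] (Fin k → ℝ) :=
  ContinuousLinearMap.pi fun q => ∑ p : Fin k, h (p + q) • ContinuousLinearMap.proj p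

theorem hankel_apply (k : ℕ) (h : ℕ → ℝ) (b : Fin k → ℝ) (q : Fin k) :
    hankel k h b q = ∑ p : Fin k, h (p + q) * b p := by
  simp [hankel, sum_apply]

/-- The quadratic form of the Hankel operator at `b` is `∑ a_i Q(m_i)²`, where `Q` is the polynomial
with coefficients `b`. If `b` is in the kernel, `Q` has degree below `k` and vanishes at `k`
distinct points, so `b = 0`. -/
theorem injective_hankel {k : ℕ} {h : ℕ → ℝ} {m a : Fin k → ℝ} (hm : Function.Injective m)
    (ha : ∀ i, 0 < a i) (hh : ∀ p, h p = ∑ i, m i ^ p * a i) :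
    Function.Injective (hankel k h) := by
  refine (injective_iff_map_eq_zero _).2 fun b hb => ?_
  have h1 : ∑ i, a i * (∑ p : Fin k, b p * m i ^ (p : ℕ)) ^ 2 = 0 := by
    calc ∑ i, a i * (∑ p : Fin k, b p * m i ^ (p : ℕ)) ^ 2
        = ∑ i, ∑ q : Fin k, ∑ p : Fin k, b q * (m i ^ (p + q : ℕ) * a i * b p) := by
          refine Finset.sum_congr rfl fun i _ => ?_
          rw [sq, Finset.sum_mul_sum, Finset.mul_sum]
          refine Finset.sum_congr rfl fun q _ => ?_
          rw [Finset.mul_sum]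
          exact Finset.sum_congr rfl fun p _ => by ring
      _ = ∑ q : Fin k, b q * hankel k h b q := by
          rw [Finset.sum_comm]
          refine Finset.sum_congr rfl fun q _ => ?_
          rw [hankel_apply, Finset.sum_comm, Finset.mul_sum]
          refine Finset.sum_congr rfl fun p _ => ?_
          rw [hh, Finset.sum_mul, Finset.mul_sum]
      _ = 0 := by simp [hb]
  have h2 := (Finset.sum_eq_zero_iff_of_nonneg
    (fun i _ => mul_nonneg (ha i).le (sq_nonneg _))).1 h1
  refine Matrix.eq_zero_of_forall_index_sum_mul_pow_eq_zero hm fun i => ?_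
  have h3 := h2 i (Finset.mem_univ i)
  simpa [(ha i).ne'] using h3

end Moments

/-! ### Smooth dependence of polynomial coefficients on moments, and of simple roots on
coefficients. -/

section Roots

variable {E : Type*} [NormedAddCommGroup E] [NormedSpace ℝ E]
  {H : Type*} [TopologicalSpace H] {I : ModelWithCorners ℝ E H}
  {M : Type*} [TopologicalSpace M] [ChartedSpace H M]

/-- The vector `c` solves a linear system with smooth coefficients that is invertible at `x`.
Invertibility persists near `x`, and inversion of operators is smooth. -/
theorem contMDiffAt_coeff_of_moments {k : ℕ} {x : M} {h : ℕ → M → ℝ}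
    (hh : ∀ p, ContMDiffAt I 𝓘(ℝ) ∞ (h p) x)
    (hinj : Function.Injective (hankel k fun p => h p x)) {c : M → Fin k → ℝ}
    (hc : ∀ᶠ y in 𝓝 x, ∀ q : Fin k, (∑ p : Fin k, h (p + q) y * c y p) + h (k + q) y = 0) :
    ContMDiffAt I 𝓘(ℝ, Fin k → ℝ) ∞ c x := by
  let G : M → (Fin k → ℝ) →L[ℝ] (Fin k → ℝ) := fun y => hankel k fun p => h p y
  let b : M → Fin k → ℝ := fun y q => -h (k + q) y
  have hb : ContMDiffAt I 𝓘(ℝ, Fin k → ℝ) ∞ b x :=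
    contMDiffAt_pi_space.2 fun q => (hh _).neg
  let s : Fin k → Fin k → (Fin k → ℝ) →L[ℝ] (Fin k → ℝ) := fun p q =>
    (ContinuousLinearMap.single ℝ (fun _ : Fin k => ℝ) q) ∘L ContinuousLinearMap.proj p
  have hGs : G = fun y => ∑ q : Fin k, ∑ p : Fin k, h (p + q) y • s p q := by
    funext y
    ext b q
    simp [G, hankel_apply, s, sum_apply, Finset.sum_apply, Pi.single_apply]
  have hG : ContMDiffAt I 𝓘(ℝ, (Fin k → ℝ) →L[ℝ] (Fin k → ℝ)) ∞ G x := by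
    rw [hGs]
    exact ContMDiffAt.sum fun q _ => ContMDiffAt.sum fun p _ => (hh _).smul contMDiffAt_const
  let e : (Fin k → ℝ) ≃L[ℝ] (Fin k → ℝ) :=
    (LinearEquiv.ofInjectiveEndo (G x : (Fin k → ℝ) →ₗ[ℝ] (Fin k → ℝ)) hinj).toContinuousLinearEquiv
  have he : (e : (Fin k → ℝ) →L[ℝ] (Fin k → ℝ)) = G x := by
    ext b q; rfl
  have hinv : ContMDiffAt I 𝓘(ℝ, (Fin k → ℝ) →L[ℝ] (Fin k → ℝ)) ∞
      (fun y => (G y).inverse) x := by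
    have h1 := contDiffAt_map_inverse (𝕜 := ℝ) (n := ∞) e
    rw [he] at h1
    exact h1.contMDiffAt.comp x hG
  refine (hinv.clm_apply hb).congr_of_eventuallyEq ?_
  have hnhds := hG.continuousAt (he ▸ ContinuousLinearEquiv.nhds e)
  filter_upwards [hc, hnhds] with y hy hey
  obtain ⟨e', he'⟩ : ∃ e' : (Fin k → ℝ) ≃L[ℝ] (Fin k → ℝ), (e' : _ →L[ℝ] _) = G y := hey
  have h2 : G y (c y) = b y := funext fun q => by
    simp only [G, hankel_apply, b]
    linarith [hy q]
  rw [← h2, ← he']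
  simp

/-- The roots are simple, so the implicit function theorem continues each of them smoothly. The
strict ordering then identifies the `i`-th branch with `μ i`. -/
theorem contMDiffAt_roots {k : ℕ} {x : M} {c : M → Fin k → ℝ}
    (hc : ContMDiffAt I 𝓘(ℝ, Fin k → ℝ) ∞ c x) {μ : Fin k → M → ℝ}
    (hμ : ∀ y, StrictMono fun i => μ i y)
    (h : ∀ y t, t ^ k + ∑ p : Fin k, c y p * t ^ (p : ℕ) = ∏ i, (t - μ i y)) (i : Fin k) :
    ContMDiffAt I 𝓘(ℝ) ∞ (μ i) x := by
  let χ : (Fin k → ℝ) × ℝ → ℝ := fun z => z.2 ^ k + ∑ p : Fin k, z.1 p * z.2 ^ (p : ℕ)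
  have hχ : ContDiff ℝ ∞ χ := by fun_prop
  have hroot : ∀ y t, χ (c y, t) = 0 ↔ ∃ j, μ j y = t := fun y t => by
    have h1 : χ (c y, t) = ∏ i, (t - μ i y) := h y t
    rw [h1, Finset.prod_eq_zero_iff]
    simp only [Finset.mem_univ, true_and, sub_eq_zero]
    exact exists_congr fun j => eq_comm
  have hex : ∀ j, ∃ r : (Fin k → ℝ) → ℝ, ContDiffAt ℝ ∞ r (c x) ∧ r (c x) = μ j x ∧
      ∀ᶠ d in 𝓝 (c x), χ (d, r d) = 0 := by
    intro j
    have hd : HasFDerivAt χ (fderiv ℝ χ (c x, μ j x)) (c x, μ j x) :=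
      (hχ.differentiable (by simp)).differentiableAt.hasFDerivAt
    have h1 : HasDerivAt (fun t => χ (c x, t)) (fderiv ℝ χ (c x, μ j x) (0, 1)) (μ j x) :=
      hd.comp_hasDerivAt (μ j x) ((hasDerivAt_const (μ j x) (c x)).prodMk (hasDerivAt_id (μ j x)))
    have h2 : HasDerivAt (fun t => ∏ i, (t - μ i x))
        (∑ i, (∏ l ∈ Finset.univ.erase i, (μ j x - μ l x)) • (1 : ℝ)) (μ j x) :=
      HasDerivAt.fun_finsetProd fun i _ => (hasDerivAt_id (μ j x)).sub_const (μ i x)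
    -- The derivative of the polynomial at its root `μ j x` is the product of the differences from
    -- the other roots.
    have h3 : fderiv ℝ χ (c x, μ j x) (0, 1) ≠ 0 := by
      have h4 : (fun t => χ (c x, t)) = fun t => ∏ i, (t - μ i x) := funext (h x)
      rw [h4] at h1
      rw [h1.unique h2, Finset.sum_eq_single j]
      · simp only [smul_eq_mul, mul_one]
        refine Finset.prod_ne_zero_iff.2 fun l hl => sub_ne_zero.2 fun hjl => ?_
        exact (Finset.mem_erase.1 hl).1 ((hμ x).injective hjl).symm
      · intro l _ hl
        rw [Finset.prod_eq_zero (Finset.mem_erase.2 ⟨hl.symm, Finset.mem_univ j⟩) (sub_self _),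
          zero_smul]
      · simp
    have h5 : (fderiv ℝ χ (c x, μ j x) ∘L ContinuousLinearMap.inr ℝ (Fin k → ℝ) ℝ).IsInvertible := by
      refine ⟨ContinuousLinearEquiv.unitsEquivAut ℝ (Units.mk0 _ h3), ?_⟩
      ext
      simp
    have hcd : ContDiffAt ℝ ∞ χ (c x, μ j x) := hχ.contDiffAt
    refine ⟨hcd.implicitFunction (by simp) h5, hcd.contDiffAt_implicitFunction (by simp) h5,
      hcd.implicitFunction_apply_self (by simp) h5, ?_⟩
    filter_upwards [hcd.eventually_apply_implicitFunction (by simp) h5] with d hd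
    rw [hd]
    exact (hroot x _).2 ⟨j, rfl⟩
  choose r hr hrx hrχ using hex
  have hrc : ∀ j, ContMDiffAt I 𝓘(ℝ) ∞ (fun y => r j (c y)) x := fun j =>
    (hr j).contMDiffAt.comp x hc
  refine (hrc i).congr_of_eventuallyEq ?_
  have hmono : ∀ᶠ y in 𝓝 x, ∀ j l : Fin k, j < l → r j (c y) < r l (c y) := by
    refine eventually_all.2 fun j => eventually_all.2 fun l => ?_
    by_cases hjl : j < l
    · have h1 : r j (c x) < r l (c x) := by rw [hrx, hrx]; exact hμ x hjl
      filter_upwards [(hrc j).continuousAt.eventually_lt (hrc l).continuousAt h1] with y hy _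
      exact hy
    · exact Eventually.of_forall fun y hlt => absurd hlt hjl
  have hzero : ∀ᶠ y in 𝓝 x, ∀ j, χ (c y, r j (c y)) = 0 :=
    eventually_all.2 fun j => hc.continuousAt.eventually (hrχ j)
  filter_upwards [hmono, hzero] with y hy hy0
  choose g hg using fun j => (hroot y _).1 (hy0 j)
  have hgm : StrictMono g := fun j l hjl => (hμ y).lt_iff_lt.1 (by
    simp only [hg]; exact hy j l hjl)
  -- The branch labels define a strictly increasing self-map of `Fin k`, which must be the identity.
  have hgid : g = id := by
    refine (hgm.range_inj strictMono_id).1 ?_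
    rw [Set.range_id]
    exact (Finite.surjective_of_injective hgm.injective).range_eq
  have := hg i
  rwa [hgid] at this

end Roots

/-! ### Smoothness of eigenvalues, and smooth sections of eigen-distributions. -/

section EigenDistributions

set_option linter.unusedSectionVars false

variable
  {E : Type*} [NormedAddCommGroup E] [NormedSpace ℝ E] [FiniteDimensional ℝ E]
  {H : Type*} [TopologicalSpace H] {I : ModelWithCorners ℝ E H}
  {M : Type*} [TopologicalSpace M] [ChartedSpace H M] [IsManifold I ∞ M]
  [RiemannianBundle (fun x : M => TangentSpace I x)]
  [IsContMDiffRiemannianBundle I ∞ E (fun x : M => TangentSpace I x)]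
  {A : ∀ x : M, TangentSpace I x →L[ℝ] TangentSpace I x} (hA : IsSmoothEndField A)
  (hsymm : ∀ (x : M) (v w : TangentSpace I x), inner ℝ (A x v) w = (inner ℝ v (A x w) : ℝ))
  {k : ℕ} {μ : Fin k → M → ℝ} (hμ : HasDistinctEigenvalues A μ)

theorem mem_eigenDistribution {A : ∀ x : M, TangentSpace I x →L[ℝ] TangentSpace I x} {r : M → ℝ}
    {x : M} {v : TangentSpace I x} : v ∈ eigenDistribution A r x ↔ A x v = r x • v :=
  Module.End.mem_eigenspace_iff

include hA in
theorem IsSmoothEndField.iterate {X : ∀ x : M, TangentSpace I x} {U : Set M} (hU : IsOpen U)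
    (hX : IsSmoothFieldOn X U) (p : ℕ) : IsSmoothFieldOn (fun y => (A y)^[p] (X y)) U := by
  induction p with
  | zero => exact hX
  | succ p ih =>
    simp only [Function.iterate_succ_apply']
    exact hA U _ hU ih

include hsymm hμ

theorem exists_sum_eigenDistribution_eq (x : M) (v : TangentSpace I x) :
    ∃ u : Fin k → TangentSpace I x, (∀ i, u i ∈ eigenDistribution A (μ i) x) ∧ ∑ i, u i = v := by
  obtain ⟨u, hu, hv⟩ := exists_sum_eigenvectors_eq (m := fun i => μ i x) (hsymm x)
    (hμ.hasEigenvalue_iff x) v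
  exact ⟨u, fun i => mem_eigenDistribution.2 (hu i), hv⟩

theorem inner_eigenDistribution_eq_zero {x : M} {i j : Fin k} (hij : i ≠ j)
    {v w : TangentSpace I x} (hv : v ∈ eigenDistribution A (μ i) x)
    (hw : w ∈ eigenDistribution A (μ j) x) : inner ℝ v w = (0 : ℝ) :=
  inner_eigenvectors_eq_zero (hsymm x) (fun h => hij ((hμ.strictMono x).injective h))
    (mem_eigenDistribution.1 hv) (mem_eigenDistribution.1 hw)

include hA

/-- If a symmetric smooth field of endomorphisms has a constant number of distinct eigenvalues,
then the eigenvalues are smooth functions. -/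
theorem contMDiff_eigenvalue (i : Fin k) : ContMDiff I 𝓘(ℝ) ∞ (μ i) := by
  intro x
  -- The test field `W` takes at `x` the sum of one nonzero eigenvector per eigenvalue, so all
  -- masses in the moment sequence at `x` are positive and the Hankel operator there is injective.
  have hex : ∀ j, ∃ w : TangentSpace I x, w ≠ 0 ∧ A x w = μ j x • w := fun j => by
    obtain ⟨w, hw⟩ := ((hμ.hasEigenvalue_iff x (μ j x)).2 ⟨j, rfl⟩).exists_hasEigenvector
    exact ⟨w, hw.2, Module.End.mem_eigenspace_iff.1 hw.1⟩
  choose w hw0 hw using hex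
  obtain ⟨U, hU, hxU, hW⟩ := isSmoothFieldOn_extend x (∑ j, w j)
  set W : ∀ y : M, TangentSpace I y := FiberBundle.extend E (∑ j, w j) with hWd
  have hWx : W x = ∑ j, w j := FiberBundle.extend_apply_self E _
  let h : ℕ → M → ℝ := fun p y => inner ℝ ((A y)^[p] (W y)) (W y)
  have hh : ∀ p, ContMDiffAt I 𝓘(ℝ) ∞ (h p) x := fun p =>
    ContMDiffAt.inner_bundle (IB := I) (F := E) (E := fun y : M => TangentSpace I y)
      (b := fun y => y) ((hA.iterate hU hW p).contMDiffAt (hU.mem_nhds hxU))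
      (hW.contMDiffAt (hU.mem_nhds hxU))
  have hmom : ∀ (y : M) (u : Fin k → TangentSpace I y), (∀ j, A y (u j) = μ j y • u j) →
      ∑ j, u j = W y → ∀ p, h p y = ∑ j, μ j y ^ p * (inner ℝ (u j) (u j) : ℝ) := by
    intro y u hu hsum p
    simp only [h, ← hsum]
    exact inner_iterate_sum_eigenvectors (m := fun j => μ j y) (hsymm y)
      (hμ.strictMono y).injective hu p
  -- Each eigenvalue occurs once here, whatever its multiplicity. The characteristic polynomial
  -- could have multiple roots, at which the implicit function theorem fails.
  let P : M → Polynomial ℝ := fun y => ∏ j, (Polynomial.X - Polynomial.C (μ j y))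
  have hmonic : ∀ y, (P y).Monic := fun y => Polynomial.monic_prod_X_sub_C _ _
  have hdeg : ∀ y, (P y).natDegree = k := fun y => by
    simp [P]
  have heval : ∀ y t, (P y).eval t = ∏ j, (t - μ j y) := fun y t => by
    simp [P, Polynomial.eval_prod]
  let c : M → Fin k → ℝ := fun y p => (P y).coeff p
  have hpoly : ∀ y t, t ^ k + ∑ p : Fin k, c y p * t ^ (p : ℕ) = ∏ j, (t - μ j y) := by
    intro y t
    rw [← heval, Polynomial.eval_eq_sum_range, hdeg, Finset.sum_range_succ,
      Fin.sum_univ_eq_sum_range (fun p => (P y).coeff p * t ^ p)]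
    have h1 := (hmonic y).coeff_natDegree
    rw [hdeg] at h1
    rw [h1]
    ring
  refine contMDiffAt_roots (contMDiffAt_coeff_of_moments hh ?_ (c := c) ?_) hμ.strictMono hpoly i
  · exact injective_hankel (m := fun j => μ j x) (a := fun j => (inner ℝ (w j) (w j) : ℝ))
      (hμ.strictMono x).injective (fun j => real_inner_self_pos.2 (hw0 j)) (hmom x w hw hWx.symm)
  -- The left side of the `q`-th equation equals `∑ |u_j|² μ_j^q P(μ_j)`, and `P` vanishes at each
  -- `μ_j`. Components `u_j` that vanish away from `x` do no harm.
  · refine Eventually.of_forall fun y q => ?_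
    obtain ⟨u, hu, hsum⟩ := exists_sum_eigenvectors_eq (m := fun i => μ i y) (hsymm y)
      (hμ.hasEigenvalue_iff y) (W y)
    simp only [hmom y u hu hsum, Finset.sum_mul]
    rw [Finset.sum_comm, ← Finset.sum_add_distrib]
    refine Finset.sum_eq_zero fun j _ => ?_
    have h1 : μ j y ^ k + ∑ p : Fin k, c y p * μ j y ^ (p : ℕ) = 0 := by
      rw [hpoly]
      exact Finset.prod_eq_zero (Finset.mem_univ j) (sub_self _)
    have h2 : ∑ p : Fin k, μ j y ^ (p + q : ℕ) * (inner ℝ (u j) (u j) : ℝ) * c y p =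
        μ j y ^ (q : ℕ) * inner ℝ (u j) (u j) * ∑ p : Fin k, c y p * μ j y ^ (p : ℕ) := by
      rw [Finset.mul_sum]
      exact Finset.sum_congr rfl fun p _ => by ring
    rw [h2, eq_neg_of_add_eq_zero_right h1]
    ring

/-- For each `j` in `s` the field is multiplied by `(A - μ_j) / (μ_i(x) - μ_j(x))`. This removes the
`D_j` component, keeps orthogonality to the eigenspaces already treated, and fixes the eigenvector
`v` at `x`. A constant denominator suffices because the value is prescribed at `x` only. -/
theorem exists_isSmoothFieldOn_orthogonal {x : M} {i : Fin k} {v : TangentSpace I x}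
    (hv : v ∈ eigenDistribution A (μ i) x) {U : Set M} (hU : IsOpen U)
    {V : ∀ y : M, TangentSpace I y} (hV : IsSmoothFieldOn V U) (hVx : V x = v)
    (s : Finset (Fin k)) (hs : i ∉ s) :
    ∃ X : ∀ y : M, TangentSpace I y, IsSmoothFieldOn X U ∧ X x = v ∧
      ∀ y, ∀ j ∈ s, ∀ w ∈ eigenDistribution A (μ j) y, inner ℝ (X y) w = (0 : ℝ) := by
  induction s using Finset.induction_on with
  | empty => exact ⟨V, hV, hVx, by simp⟩
  | insert j s hj ih =>
    rw [Finset.mem_insert, not_or] at hs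
    obtain ⟨X, hX, hXx, hXo⟩ := ih hs.2
    have hne : μ i x - μ j x ≠ 0 :=
      sub_ne_zero.2 fun h => hs.1 ((hμ.strictMono x).injective h)
    refine ⟨fun y => (μ i x - μ j x)⁻¹ • (A y (X y) - μ j y • X y), fun y hy => ?_, ?_, ?_⟩
    · refine ContMDiffWithinAt.smul_section contMDiffWithinAt_const ?_
      exact ContMDiffWithinAt.sub_section (hA U X hU hX y hy)
        (ContMDiffWithinAt.smul_section
          ((contMDiff_eigenvalue hA hsymm hμ j).contMDiffAt.contMDiffWithinAt) (hX y hy))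
    · change (μ i x - μ j x)⁻¹ • (A x (X x) - μ j x • X x) = v
      rw [hXx, mem_eigenDistribution.1 hv, ← sub_smul, inv_smul_smul₀ hne]
    · intro y l hl w hw
      have hw' := mem_eigenDistribution.1 hw
      rw [inner_smul_left, inner_sub_left, hsymm, hw', inner_smul_left, inner_smul_right]
      rcases Finset.mem_insert.1 hl with rfl | hl
      · simp
      · simp [hXo y l hl w hw]

/-- Every vector of an eigen-distribution extends to a smooth local section. -/
theorem exists_isSmoothFieldOn_eigenDistribution {x : M} {i : Fin k} {v : TangentSpace I x}
    (hv : v ∈ eigenDistribution A (μ i) x) :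
    ∃ (U : Set M) (X : ∀ y : M, TangentSpace I y), IsOpen U ∧ x ∈ U ∧ IsSmoothFieldOn X U ∧
      X x = v ∧ ∀ y, X y ∈ eigenDistribution A (μ i) y := by
  obtain ⟨U, hU, hxU, hV⟩ := isSmoothFieldOn_extend x v
  -- A vector orthogonal to every eigenspace other than the `i`-th lies in the `i`-th.
  obtain ⟨X, hX, hXx, hXo⟩ := exists_isSmoothFieldOn_orthogonal hA hsymm hμ hv hU hV
    (FiberBundle.extend_apply_self E v) (Finset.univ.erase i) (Finset.notMem_erase i _)
  refine ⟨U, X, hU, hxU, hX, hXx, fun y => ?_⟩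
  obtain ⟨u, hu, hsum⟩ := exists_sum_eigenDistribution_eq hsymm hμ y (X y)
  have h0 : ∀ j, j ≠ i → u j = 0 := by
    intro j hj
    have h1 := hXo y j (Finset.mem_erase.2 ⟨hj, Finset.mem_univ j⟩) (u j) (hu j)
    rw [← hsum, sum_inner, Finset.sum_eq_single j] at h1
    · exact inner_self_eq_zero.1 h1
    · exact fun l _ hl => inner_eigenDistribution_eq_zero hsymm hμ hl (hu l) (hu j)
    · simp
  rw [← hsum, Finset.sum_eq_single i (fun j _ hj => h0 j hj) (by simp)]
  exact hu i

end EigenDistributions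

/-! ### Integrability of the orthogonal complements in terms of `𝒜`. -/

section Codazzi

set_option linter.unusedSectionVars false

variable
  {E : Type*} [NormedAddCommGroup E] [NormedSpace ℝ E] [FiniteDimensional ℝ E]
  {H : Type*} [TopologicalSpace H] {I : ModelWithCorners ℝ E H}
  {M : Type*} [TopologicalSpace M] [ChartedSpace H M] [IsManifold I ∞ M]
  [RiemannianBundle (fun x : M => TangentSpace I x)]
  [IsContMDiffRiemannianBundle I ∞ E (fun x : M => TangentSpace I x)]
  {cov : CovariantDerivative I E (TangentSpace I : M → Type _)} (hcov : IsLeviCivita cov)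
  {A : ∀ x : M, TangentSpace I x →L[ℝ] TangentSpace I x} (hA : IsSmoothEndField A)
  (hsymm : ∀ (x : M) (v w : TangentSpace I x), inner ℝ (A x v) w = (inner ℝ v (A x w) : ℝ))

theorem integrabilityTensor_orthogonal_eq_zero_iff {D : ∀ x : M, Submodule ℝ (TangentSpace I x)}
    {X Y : ∀ x : M, TangentSpace I x} {x : M} :
    integrabilityTensor (fun x => (D x)ᗮ) X Y x = 0 ↔
      ∀ u ∈ D x, inner ℝ (mlieBracket I X Y x) u = (0 : ℝ) := by
  rw [integrabilityTensor, smul_eq_zero, or_iff_right (by norm_num),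
    Submodule.starProjection_apply_eq_zero_iff, Submodule.orthogonal_orthogonal,
    Submodule.mem_orthogonal']

include hcov hA hsymm

/-- Obtained by differentiating the symmetry `⟨A X, Y⟩ = ⟨X, A Y⟩`. -/
theorem codazziTensor_swap_right (x : M) (u v w : TangentSpace I x) :
    codazziTensor cov A x u v w = codazziTensor cov A x u w v := by
  obtain ⟨U, hU, hxU, hX⟩ := isSmoothFieldOn_extend x v
  obtain ⟨V, hV, hxV, hY⟩ := isSmoothFieldOn_extend x w
  set X : ∀ y : M, TangentSpace I y := FiberBundle.extend E v with hXd
  set Y : ∀ y : M, TangentSpace I y := FiberBundle.extend E w with hYd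
  have hXx : X x = v := FiberBundle.extend_apply_self E v
  have hYx : Y x = w := FiberBundle.extend_apply_self E w
  have hXm := hX.mdifferentiableAt hU hxU
  have hYm := hY.mdifferentiableAt hV hxV
  have h1 := hcov.metric x _ _ (hA.mdifferentiableAt hXm) hYm u
  have h2 := hcov.metric x _ _ hXm (hA.mdifferentiableAt hYm) u
  rw [mvfderiv_congr (Eventually.of_forall fun y => hsymm y (X y) (Y y)) u, h2] at h1
  have h3 : codazziTensor cov A x u v w =
    inner ℝ (cov (fun y => A y (X y)) x u - A x (cov X x u)) w := rfl
  have h4 : codazziTensor cov A x u w v =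
    inner ℝ (cov (fun y => A y (Y y)) x u - A x (cov Y x u)) v := rfl
  rw [h3, h4, inner_sub_left, inner_sub_left, hsymm, hsymm, real_inner_comm v, real_inner_comm _ (cov Y x u)]
  rw [hXx, hYx] at h1
  linarith

variable {k : ℕ} {μ : Fin k → M → ℝ} (hμ : HasDistinctEigenvalues A μ)

include hμ

/-- The tensor `𝒜` evaluated on a section of an eigen-distribution and on a vector of another
eigen-distribution. -/
theorem codazziTensor_eigenDistribution {x : M} {i j : Fin k} (hij : i ≠ j) {U : Set M}
    (hU : IsOpen U) (hx : x ∈ U) {X : ∀ y : M, TangentSpace I y} (hX : IsSmoothFieldOn X U)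
    (hXi : ∀ y, X y ∈ eigenDistribution A (μ i) y) (v : TangentSpace I x) {w : TangentSpace I x}
    (hw : w ∈ eigenDistribution A (μ j) x) :
    codazziTensor cov A x v (X x) w = (μ i x - μ j x) * inner ℝ (cov X x v) w := by
  have hXm := hX.mdifferentiableAt hU hx
  have h1 : (fun y => A y (X y)) = μ i • X := funext fun y => mem_eigenDistribution.1 (hXi y)
  -- The product rule for `μ i • X` produces a term along `X x`, which is orthogonal to `w`. Only
  -- the difference of eigenvalues survives.
  have h2 := cov.isCovariantDerivativeOnUniv.leibniz hXm
    ((contMDiff_eigenvalue hA hsymm hμ i).mdifferentiable (by simp) x)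
  rw [codazziTensor, covDerivEnd_eq hA hXm, h1, h2, inner_sub_left, hsymm,
    mem_eigenDistribution.1 hw]
  simp only [add_apply, smul_apply, ContinuousLinearMap.smulRight_apply, inner_add_left,
    inner_smul_left, inner_smul_right, inner_eigenDistribution_eq_zero hsymm hμ hij (hXi x) hw]
  simp only [conj_trivial]
  ring

/-- Since `Y` and `Z` are orthogonal to `X`, metric compatibility moves the derivatives in `⟨∇_Y Z -
∇_Z Y, X⟩` onto `X`. Integrability becomes symmetry of `(v, w) ↦ ⟨∇_v X, w⟩`, which involves `Y` and
`Z` only through their values at `x`. -/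
theorem inner_mlieBracket_eigenDistribution {x : M} {i : Fin k} {U : Set M}
    (hU : IsOpen U) (hx : x ∈ U) {X Y Z : ∀ y : M, TangentSpace I y} (hX : IsSmoothFieldOn X U)
    (hXi : ∀ y, X y ∈ eigenDistribution A (μ i) y) (hY : IsSmoothFieldOn Y U)
    (hZ : IsSmoothFieldOn Z U) (hYi : ∀ y ∈ U, Y y ∈ (eigenDistribution A (μ i) y)ᗮ)
    (hZi : ∀ y ∈ U, Z y ∈ (eigenDistribution A (μ i) y)ᗮ) :
    (inner ℝ (mlieBracket I Y Z x) (X x) : ℝ) =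
      inner ℝ (cov X x (Z x)) (Y x) - inner ℝ (cov X x (Y x)) (Z x) := by
  have hXm := hX.mdifferentiableAt hU hx
  have key : ∀ W : ∀ y : M, TangentSpace I y, IsSmoothFieldOn W U →
      (∀ y ∈ U, W y ∈ (eigenDistribution A (μ i) y)ᗮ) → ∀ v,
      inner ℝ (cov W x v) (X x) = -(inner ℝ (cov X x v) (W x) : ℝ) := by
    intro W hW hWi v
    have h1 := hcov.metric x W X (hW.mdifferentiableAt hU hx) hXm v
    have h2 : (fun y => (inner ℝ (W y) (X y) : ℝ)) =ᶠ[𝓝 x] fun _ => 0 := by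
      filter_upwards [hU.mem_nhds hx] with y hy
      exact Submodule.inner_left_of_mem_orthogonal (hXi y) (hWi y hy)
    rw [mvfderiv_congr h2 v, mvfderiv_const, real_inner_comm _ (W x)] at h1
    simp only [zero_apply] at h1
    linarith
  rw [← hcov.cov_sub_cov (hY.mdifferentiableAt hU hx) (hZ.mdifferentiableAt hU hx),
    inner_sub_left, key Z hZ hZi, key Y hY hYi]
  ring

theorem eigenDistribution_le_orthogonal {i j : Fin k} (hij : i ≠ j) (x : M) :
    eigenDistribution A (μ j) x ≤ (eigenDistribution A (μ i) x)ᗮ := fun _ hw =>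
  (Submodule.mem_orthogonal _ _).2 fun _ hu => inner_eigenDistribution_eq_zero hsymm hμ hij hu hw

variable (hcod : ∀ (x : M) (v w : TangentSpace I x),
  covDerivEnd cov A x v w = covDerivEnd cov A x w v)

include hcod

theorem codazziTensor_swap_left (x : M) (u v w : TangentSpace I x) :
    codazziTensor cov A x u v w = codazziTensor cov A x v u w := by
  rw [codazziTensor, hcod]
  rfl

/-- Integrability gives `⟨∇_v X, w⟩ = ⟨∇_w X, v⟩`, while the symmetry of `𝒜` gives `(μ_i - μ_l)⟨∇_v
X, w⟩ = (μ_i - μ_j)⟨∇_w X, v⟩`. As `μ_j ≠ μ_l`, both inner products vanish, and `𝒜` with them. -/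
theorem codazziTensor_eq_zero_of_isIntegrable {i j l : Fin k} (hij : i ≠ j) (hil : i ≠ l)
    (hjl : j ≠ l) (hint : IsIntegrable fun x => (eigenDistribution A (μ i) x)ᗮ) {x : M}
    {u v w : TangentSpace I x} (hu : u ∈ eigenDistribution A (μ i) x)
    (hv : v ∈ eigenDistribution A (μ j) x) (hw : w ∈ eigenDistribution A (μ l) x) :
    codazziTensor cov A x u v w = 0 := by
  obtain ⟨U₁, X, hU₁, hx₁, hX, hXx, hXi⟩ :=
    exists_isSmoothFieldOn_eigenDistribution hA hsymm hμ hu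
  obtain ⟨U₂, Y, hU₂, hx₂, hY, hYx, hYj⟩ :=
    exists_isSmoothFieldOn_eigenDistribution hA hsymm hμ hv
  obtain ⟨U₃, Z, hU₃, hx₃, hZ, hZx, hZl⟩ :=
    exists_isSmoothFieldOn_eigenDistribution hA hsymm hμ hw
  have hU : IsOpen (U₁ ∩ U₂ ∩ U₃) := (hU₁.inter hU₂).inter hU₃
  have hx : x ∈ U₁ ∩ U₂ ∩ U₃ := ⟨⟨hx₁, hx₂⟩, hx₃⟩
  replace hX : IsSmoothFieldOn X (U₁ ∩ U₂ ∩ U₃) := hX.mono fun _ h => h.1.1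
  replace hY : IsSmoothFieldOn Y (U₁ ∩ U₂ ∩ U₃) := hY.mono fun _ h => h.1.2
  replace hZ : IsSmoothFieldOn Z (U₁ ∩ U₂ ∩ U₃) := hZ.mono fun _ h => h.2
  have hYi : ∀ y ∈ U₁ ∩ U₂ ∩ U₃, Y y ∈ (eigenDistribution A (μ i) y)ᗮ := fun y _ =>
    eigenDistribution_le_orthogonal hcov hA hsymm hμ hij y (hYj y)
  have hZi : ∀ y ∈ U₁ ∩ U₂ ∩ U₃, Z y ∈ (eigenDistribution A (μ i) y)ᗮ := fun y _ =>
    eigenDistribution_le_orthogonal hcov hA hsymm hμ hil y (hZl y)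
  have h1 := integrabilityTensor_orthogonal_eq_zero_iff.1
    (hint _ hU Y Z hY hZ hYi hZi x hx) (X x) (hXi x)
  rw [inner_mlieBracket_eigenDistribution hcov hA hsymm hμ hU hx hX hXi hY hZ hYi hZi,
    hYx, hZx] at h1
  have h2 := codazziTensor_eigenDistribution hcov hA hsymm hμ hij hU hx hX hXi w hv
  have h3 := codazziTensor_eigenDistribution hcov hA hsymm hμ hil hU hx hX hXi v hw
  rw [hXx] at h2 h3
  have h4 : codazziTensor cov A x w u v = codazziTensor cov A x v u w := by
    rw [codazziTensor_swap_right hcov hA hsymm, codazziTensor_swap_left hcov hA hsymm hμ hcod,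
      codazziTensor_swap_right hcov hA hsymm]
  have h5 : codazziTensor cov A x u v w = codazziTensor cov A x v u w :=
    codazziTensor_swap_left hcov hA hsymm hμ hcod x u v w
  have h6 : (μ l x - μ j x) * (inner ℝ (cov X x v) w : ℝ) = 0 := by
    rw [h4, h3, sub_eq_zero.1 h1] at h2
    linarith
  have h7 := (mul_eq_zero.1 h6).resolve_left
    (sub_ne_zero.2 fun h => hjl ((hμ.strictMono x).injective h).symm)
  rw [h5, h3, h7, mul_zero]

/-- The two transpositions generate all permutations of the arguments, so the ordered case covers
every arrangement of three distinct indices. -/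
theorem codazziTensor_eq_zero_of_pairwise_ne
    (h : ∀ i j l : Fin k, i < j → j < l → ∀ (x : M) (u v w : TangentSpace I x),
      u ∈ eigenDistribution A (μ i) x → v ∈ eigenDistribution A (μ j) x →
      w ∈ eigenDistribution A (μ l) x → codazziTensor cov A x u v w = 0)
    {i j l : Fin k} (hij : i ≠ j) (hil : i ≠ l) (hjl : j ≠ l) {x : M} {u v w : TangentSpace I x}
    (hu : u ∈ eigenDistribution A (μ i) x) (hv : v ∈ eigenDistribution A (μ j) x)
    (hw : w ∈ eigenDistribution A (μ l) x) : codazziTensor cov A x u v w = 0 := by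
  have hl := codazziTensor_swap_left hcov hA hsymm hμ hcod x
  have hr := codazziTensor_swap_right hcov hA hsymm x
  rcases hij.lt_or_gt with h1 | h1 <;> rcases hil.lt_or_gt with h2 | h2 <;>
    rcases hjl.lt_or_gt with h3 | h3
  · exact h i j l h1 h3 x u v w hu hv hw
  · rw [hr]; exact h i l j h2 h3 x u w v hu hw hv
  · exact absurd (h1.trans h3) h2.asymm
  · rw [hr, hl]; exact h l i j h2 h1 x w u v hw hu hv
  · rw [hl]; exact h j i l h1 h2 x v u w hv hu hw
  · exact absurd (h3.trans h1) h2.asymm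
  · rw [hl, hr]; exact h j l i h3 h2 x v w u hv hw hu
  · rw [hl, hr, hl]; exact h l j i h3 h1 x w v u hw hv hu

theorem isIntegrable_orthogonal_eigenDistribution
    (h : ∀ i j l : Fin k, i < j → j < l → ∀ (x : M) (u v w : TangentSpace I x),
      u ∈ eigenDistribution A (μ i) x → v ∈ eigenDistribution A (μ j) x →
      w ∈ eigenDistribution A (μ l) x → codazziTensor cov A x u v w = 0) (i : Fin k) :
    IsIntegrable fun x => (eigenDistribution A (μ i) x)ᗮ := by
  intro U hU Y Z hY hZ hYi hZi x hx
  refine integrabilityTensor_orthogonal_eq_zero_iff.2 fun u hu => ?_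
  obtain ⟨V, X, hV, hxV, hX, hXx, hXi⟩ :=
    exists_isSmoothFieldOn_eigenDistribution hA hsymm hμ hu
  rw [← hXx, inner_mlieBracket_eigenDistribution hcov hA hsymm hμ (hU.inter hV) ⟨hx, hxV⟩
    (hX.mono inter_subset_right) hXi (hY.mono inter_subset_left) (hZ.mono inter_subset_left)
    (fun y hy => hYi y hy.1) (fun y hy => hZi y hy.1), sub_eq_zero]
  have hdec : ∀ W ∈ (eigenDistribution A (μ i) x)ᗮ, ∃ p : Fin k → TangentSpace I x,
      (∀ j, p j ∈ eigenDistribution A (μ j) x) ∧ ∑ j, p j = W ∧ p i = 0 := by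
    intro W hW
    obtain ⟨p, hp, hsum⟩ := exists_sum_eigenDistribution_eq hsymm hμ x W
    refine ⟨p, hp, hsum, ?_⟩
    have h1 := Submodule.inner_left_of_mem_orthogonal (hp i) hW
    rw [← hsum, sum_inner, Finset.sum_eq_single i] at h1
    · exact inner_self_eq_zero.1 h1
    · exact fun j _ hj => inner_eigenDistribution_eq_zero hsymm hμ hj (hp j) (hp i)
    · simp
  obtain ⟨p, hp, hpY, hpi⟩ := hdec (Y x) (hYi x hx)
  obtain ⟨q, hq, hqZ, hqi⟩ := hdec (Z x) (hZi x hx)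
  -- Symmetry of the form is checked on eigencomponents. For `j = l` the nonzero factor `μ i x - μ j
  -- x` cancels from the symmetry of `𝒜`; for `j ≠ l`, both different from `i`, the hypothesis makes
  -- each side zero.
  have key : ∀ j l, (inner ℝ (cov X x (q l)) (p j) : ℝ) = inner ℝ (cov X x (p j)) (q l) := by
    intro j l
    by_cases hj : i = j
    · subst hj; simp [hpi]
    by_cases hl : i = l
    · subst hl; simp [hqi]
    have hne : ∀ {m : Fin k}, i ≠ m → μ i x - μ m x ≠ 0 := fun hm =>
      sub_ne_zero.2 fun h => hm ((hμ.strictMono x).injective h)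
    have h1 := codazziTensor_eigenDistribution hcov hA hsymm hμ hj hV hxV hX hXi (q l) (hp j)
    have h2 := codazziTensor_eigenDistribution hcov hA hsymm hμ hl hV hxV hX hXi (p j) (hq l)
    by_cases hjl : j = l
    · subst hjl
      have h3 : codazziTensor cov A x (q j) (X x) (p j) =
          codazziTensor cov A x (p j) (X x) (q j) := by
        rw [codazziTensor_swap_right hcov hA hsymm, codazziTensor_swap_left hcov hA hsymm hμ hcod,
          codazziTensor_swap_right hcov hA hsymm]
      rw [h1, h2] at h3
      exact mul_left_cancel₀ (hne hj) h3
    · have h3 := codazziTensor_eq_zero_of_pairwise_ne hcov hA hsymm hμ hcod h (Ne.symm hl)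
        (Ne.symm hjl) hj (hq l) (hXi x) (hp j)
      have h4 := codazziTensor_eq_zero_of_pairwise_ne hcov hA hsymm hμ hcod h (Ne.symm hj)
        hjl hl (hp j) (hXi x) (hq l)
      rw [h1] at h3
      rw [h2] at h4
      rw [(mul_eq_zero.1 h3).resolve_left (hne hj), (mul_eq_zero.1 h4).resolve_left (hne hl)]
  rw [← hpY, ← hqZ, map_sum, map_sum, sum_inner, sum_inner]
  simp only [inner_sum, key]
  exact Finset.sum_comm

end Codazzi

end RiemannianHypersurface

/-! ### The characterization of integrability for hypersurfaces of space forms. -/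

theorem mainTheorem11 {n k : ℕ} (hk : 2 < k) (c : ℝ)
    {M : Type*} [TopologicalSpace M] [T2Space M] [ChartedSpace (EuclideanSpace ℝ (Fin n)) M]
    [IsManifold (𝓡 n) ∞ M]
    [Bundle.RiemannianBundle (fun x : M => TangentSpace (𝓡 n) x)]
    [IsContMDiffRiemannianBundle (𝓡 n) ∞ (EuclideanSpace ℝ (Fin n))
      (fun x : M => TangentSpace (𝓡 n) x)]
    {M' : Type*} [TopologicalSpace M'] [T2Space M']
    [ChartedSpace (EuclideanSpace ℝ (Fin (n + 1))) M']
    [IsManifold (𝓡 (n + 1)) ∞ M']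
    [Bundle.RiemannianBundle (fun y : M' => TangentSpace (𝓡 (n + 1)) y)]
    [IsContMDiffRiemannianBundle (𝓡 (n + 1)) ∞ (EuclideanSpace ℝ (Fin (n + 1)))
      (fun y : M' => TangentSpace (𝓡 (n + 1)) y)]
    (cov : CovariantDerivative (𝓡 n) (EuclideanSpace ℝ (Fin n))
      (TangentSpace (𝓡 n) : M → Type _))
    (hcov : RiemannianHypersurface.IsLeviCivita cov)
    (cov' : CovariantDerivative (𝓡 (n + 1)) (EuclideanSpace ℝ (Fin (n + 1)))
      (TangentSpace (𝓡 (n + 1)) : M' → Type _))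
    (hcov' : RiemannianHypersurface.IsLeviCivita cov')
    (hcurv : RiemannianHypersurface.HasConstantCurvature cov' c)
    (f : M → M') (ν : ∀ x : M, TangentSpace (𝓡 (n + 1)) (f x))
    (hf : RiemannianHypersurface.IsOrientedImmersion (𝓡 n) f ν)
    (A : ∀ x : M, TangentSpace (𝓡 n) x →L[ℝ] TangentSpace (𝓡 n) x)
    (hA : A = RiemannianHypersurface.shapeOperator cov' f ν)
    (μ : Fin k → M → ℝ)
    (hμ : RiemannianHypersurface.HasDistinctEigenvalues A μ)
    (D : Fin k → ∀ x : M, Submodule ℝ (TangentSpace (𝓡 n) x))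
    (hD : ∀ i, D i = RiemannianHypersurface.eigenDistribution A (μ i)) :
    (∀ i, RiemannianHypersurface.IsIntegrable (fun x => (D i x)ᗮ)) ↔
      ∀ i j l : Fin k, i < j → j < l → ∀ (x : M) (u v w : TangentSpace (𝓡 n) x),
        u ∈ D i x → v ∈ D j x → w ∈ D l x →
          RiemannianHypersurface.codazziTensor cov A x u v w = 0 := by
  subst hA
  obtain rfl : D = fun i => RiemannianHypersurface.eigenDistribution _ (μ i) := funext hD
  have hdim : Module.finrank ℝ (EuclideanSpace ℝ (Fin (n + 1))) =
      Module.finrank ℝ (EuclideanSpace ℝ (Fin n)) + 1 := by simp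
  have hAs := RiemannianHypersurface.isSmoothEndField_shapeOperator hcov' hf hdim
  have hsymm := RiemannianHypersurface.shapeOperator_symmetric hcov' hf
  have hcod := RiemannianHypersurface.codazzi hcov' hf hcov hdim hcurv
  refine ⟨fun h i j l hij hjl x u v w hu hv hw => ?_, fun h i => ?_⟩
  · exact RiemannianHypersurface.codazziTensor_eq_zero_of_isIntegrable hcov hAs hsymm hμ hcod
      hij.ne (hij.trans hjl).ne hjl.ne (h i) hu hv hw
  · exact RiemannianHypersurface.isIntegrable_orthogonal_eigenDistribution hcov hAs hsymm hμ hcod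
      h i
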